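/- **Setting.** For an integer $k\ge 1$ and $x,\theta>0$ let $\psi_k(x,\theta)=\frac{k}{\theta}\left(1-\frac{x}{\theta}\right)_+^{k-1}$ (with $\psi_1(\cdot,\theta)=\theta^{-1}\mathbb 1_{(0,\theta)}$). For $k,J\ge1$, $\beta=(\beta_0,\dots,\beta_k)$ and $w=(w_1,\dots,w_J)$ in the probability simplices and $\theta\in(0,1)^J$ let $$g_{k,J,\beta,w,\theta}(x)=\sum_{j=0}^{k-1}\beta_j\,\psi_{j+1}(x,1)+\beta_k\sum_{l=1}^{J}w_l\,\psi_k(x,\theta_l),\qquad x\in(0,1).$$ **Prior at sample size $n\ge2$.** The integers $k,J\ge 1$ are independent with $\Pi(k)=(n^r-1)n^{-rk}$ and $\Pi(J)=(n^c-1)n^{-cJ}$, where $r,c>0$. Given $(k,J)$, the following are independent: $\beta\sim\mathrm{Dir}(a_{k,0},\dots,a_{k,k})$; $w\sim\mathrm{Dir}(J;\omega_{1J},\dots,\omega_{JJ})$; and $\theta_1,\dots,\theta_J$ i.i.d. from $H_n$. Here the $a_{k,j}$ lie between two fixed positive numbers, the $\omega_{jJ}$ are positive, and $H_n$ is a probability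 measure on $(0,1)$ with Lebesgue density $p_{H_n}$ such that, for some constants $t_2,t_3,C_1,C_2>0$ that do not depend on $n$, $$H_n((u,v))\ge C_1(v-u)^{t_2}\ \text{ for all intervals }(u,v)\subset(n^{-2},1),\qquad p_{H_n}(\theta)\le C_2e^{-t_3/\theta}\ \text{ for all }\theta\in(0,n^{-2}).$$ **Theorem.** There is $c_0>0$, depending only on these prior specifications and not on the true density, such that for every $c\ge c_0$ the following holds. Let $X_1,\dots,X_n$ be i.i.d. with density $$g_0(x)=\sum_{j=0}^{k_0-1}\beta_{0,j}\,\psi_{j+1}(x,1)+\beta_{0,k_0}\sum_{l=1}^{J_0}w^0_l\,\psi_{k_0}(x,\theta^0_l),$$ where $k_0,J_0\ge1$, $\beta_0$ and $w^0$ are in the probability simplices, $\theta^0_l\in(0,1)$, and $\beta_{0,0}>0$. The truth $(k_0,J_0,\beta_0,w^0,\theta^0)$ may depend on $n$, provided that $\beta_{0,0}$, all $\theta^0_l$ and all $\omega_{lJ_0}$ $(1\le l\le J_0)$ are bounded below, and the $\omega_{lJ_0}$ also above, by positive constants not depending on $n$ (this is automatic if the truth is fixed). Then for every $n\ge2$ the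 posterior is well defined almost surely (its normalizing constant is positive and finite), and with $$\epsilon_n=\sqrt{\max(k_0,J_0)\,(\log n)/n}$$ the posterior contracts at $g_0$ at the rate $\epsilon_n$ in the Hellinger distance $d_H(p,q)=\|\sqrt p-\sqrt q\|_{L_2(0,1)}$: for every sequence $M_n\to\infty$, $$\mathrm E_0\big[\Pi\big(d_H(g,g_0)\ge M_n\epsilon_n\mid X_1,\dots,X_n\big)\big]\longrightarrow0 .$$ -/

import Mathlib

open MeasureTheory ProbabilityTheory Filter Topology
open scoped ENNReal

noncomputable section

namespace KMonotone

/-- The kernel `ψ_k(x, θ) = (k / θ) (1 - x / θ)_+ ^ (k - 1)` for `x, θ > 0`, where a zeroth power of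
the positive part is the indicator of `x < θ` (so that `ψ_1(·, θ)` is the uniform density on
`(0, θ)`). -/
def kernel (k : ℕ) (x θ : ℝ) : ℝ :=
  if x < θ then (k : ℝ) / θ * (1 - x / θ) ^ (k - 1) else 0

/-- The density
`x ↦ ∑_{j < k} β_j ψ_{j+1}(x, 1) + β_k ∑_{l ≤ J} w_l ψ_k(x, θ_l)` on `(0, 1)`. -/
def mixDensity (k J : ℕ) (β : Fin (k + 1) → ℝ) (w θ : Fin J → ℝ) (x : ℝ) : ℝ :=
  ∑ j : Fin k, β j.castSucc * kernel (j + 1) x 1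
    + β (Fin.last k) * ∑ l : Fin J, w l * kernel k x (θ l)

/-- The Hellinger distance `‖√p - √q‖₂` of two densities on `(0, 1)`. -/
def hellinger (p q : ℝ → ℝ) : ℝ≥0∞ :=
  eLpNorm (fun x => √(p x) - √(q x)) 2 (volume.restrict (Set.Ioo 0 1))

/-- The probability measure on `(0, 1)` with Lebesgue density `p`. -/
def law (p : ℝ → ℝ) : Measure ℝ :=
  (volume.restrict (Set.Ioo 0 1)).withDensity fun x => ENNReal.ofReal (p x)

/-- The Dirichlet distribution on the simplex with parameters `α i > 0`: the law of
`(Y_i / ∑ Y_j)_i` for independent `Y_i ∼ Gamma(α i, 1)`. -/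
def dirichlet {ι : Type} [Fintype ι] (α : ι → ℝ) : Measure (ι → ℝ) :=
  (Measure.pi fun i => gammaMeasure (α i) 1).map fun y i => y i / ∑ j, y j

/-- The parameters of the model: the pair `(k, J)`, then `(β, w, θ)`. -/
abbrev Param : Type :=
  Σ m : ℕ × ℕ, (Fin (m.1 + 1) → ℝ) × (Fin m.2 → ℝ) × (Fin m.2 → ℝ)

/-- The density that belongs to a parameter. -/
def Param.density (ξ : Param) : ℝ → ℝ :=
  mixDensity ξ.1.1 ξ.1.2 ξ.2.1 ξ.2.2.1 ξ.2.2.2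

/-- The weights `(n ^ s - 1) n ^ (-s m)`, `m = 1, 2, …`, of a prior on the positive integers
(a probability distribution for `n ≥ 2` and `s > 0`). -/
def geomWeight (n : ℕ) (s : ℝ) (m : ℕ) : ℝ≥0∞ :=
  if 1 ≤ m then ENNReal.ofReal (((n : ℝ) ^ s - 1) * (n : ℝ) ^ (-(s * m))) else 0

/-- The prior at sample size `n`: `k` and `J` are independent with weights `geomWeight n r` and
`geomWeight n c`; given `(k, J)`, the vectors `β ∼ Dir(a_0, …, a_k)`, `w ∼ Dir(J; ω_1, …, ω_J)` and
`θ_1, …, θ_J` i.i.d. from `H` are independent. -/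
def prior (n : ℕ) (r c : ℝ) (a : (k : ℕ) → Fin (k + 1) → ℝ) (ω : (J : ℕ) → Fin J → ℝ)
    (H : Measure ℝ) : Measure Param :=
  Measure.sum fun m : ℕ × ℕ =>
    (geomWeight n r m.1 * geomWeight n c m.2) •
      ((dirichlet (a m.1)).prod ((dirichlet (ω m.2)).prod
        (Measure.pi fun _ : Fin m.2 => H))).map (Sigma.mk m)

/-- The likelihood of the parameter `ξ` for the sample `x`. -/
def likelihood {n : ℕ} (x : Fin n → ℝ) (ξ : Param) : ℝ≥0∞ :=
  ∏ i, ENNReal.ofReal (ξ.density (x i))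

/-- The marginal density of the sample `x`, the normalizing constant of the posterior. -/
def evidence (Λ : Measure Param) {n : ℕ} (x : Fin n → ℝ) : ℝ≥0∞ :=
  ∫⁻ ξ, likelihood x ξ ∂Λ

/-- The posterior probability of `A` given the sample `x` under the prior `Λ`, by Bayes' formula. -/
def posterior (Λ : Measure Param) {n : ℕ} (x : Fin n → ℝ) (A : Set Param) : ℝ≥0∞ :=
  (∫⁻ ξ in A, likelihood x ξ ∂Λ) / evidence Λ x

end KMonotone

end

/-!
The posterior is controlled by one-sided envelopes of the mixtures rather than by Kullback-Leibler
neighbourhoods and tests. Write `m = max k₀ J₀`, so that `n ε_n ^ 2 = m log n`, and let `L` and `L₀`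
be the likelihoods of a parameter and of the truth.

*Two inequalities for the kernel.* As `ψ_k(x, θ) = θ⁻¹ φ(x / θ)` with `φ` decreasing, moving `θ`
up to `θ'` gives `ψ_k(x, θ) ≤ (θ' / θ) ψ_k(x, θ')` (`kernel_le_mul_kernel`). In the other direction,
moving `θ₀` down by less than `n⁻⁶` changes `ψ_k(x, θ₀)` by a factor at least `1 - 1 / n`, unless
`x` lies in the window of length `n⁻⁴` to the left of `θ₀` (`mul_kernel_le_kernel`).

*Numerator.* By the first inequality, rounding all of `β, w, θ` up to multiples of `n⁻⁶` yields
upper brackets `u ≥ g` with `∫ u ≤ 1 + n⁻²` (`exists_upper_brackets`). The sieve `k, J ≤ A m`,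
`θ ≥ n⁻²` needs `n ^ O(m)` of them. If a bracket contains a density at Hellinger distance at least
`h` from `g₀`, its affinity with `g₀` is at most `1 + 1 / n - h ^ 2 / 2` (`lintegral_sqrt_mul_le`),
so `∏ √(u(X_i) / g₀(X_i))` has expectation at most `exp (1 - n h ^ 2 / 2)`. For `h = M_n ε_n` this
beats every fixed power `n ^ (C m)`. Off the sieve, Fubini's theorem bounds the expected numerator
`∫ L / L₀` by the prior mass (`lintegral_lintegral_likelihoodRatio_le`), which is at most
`n ^ (-r A m) + n ^ (-c A m)` up to a term of order `exp (-t₃ n ^ 2)` (`prior_compl_sieve_le`).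

*Denominator.* The windows contain no observation, with probability `1 - O(1 / n)`. On that event
the second inequality gives `g ≥ (1 - 1 / n) ^ 3 g₀` at the data, hence `L ≥ e⁻⁶ L₀`, for all
parameters in a neighbourhood of the truth of prior mass at least `n ^ (-O(m))`
(`exists_dirichlet_ge`, `exists_evidence_ge`).

The three parts are combined in `lintegral_posterior_le`. As the exponent in the bound of the
denominator does not involve `A`, taking `A` large makes the sieve work for every `c > 0`; the
threshold for `c` may be any positive number. If `M_n ε_n > √2` the claim is trivial, because the
Hellinger distance of two densities does not exceed `√2`; otherwise `m ≤ n` for large `n`, which is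
used throughout.
-/

namespace KMonotone

/-! ### Kernels and their mixtures -/

lemma measurable_kernel_uncurry (k : ℕ) : Measurable fun p : ℝ × ℝ => kernel k p.1 p.2 := by
  unfold kernel
  refine Measurable.ite (measurableSet_lt measurable_fst measurable_snd) ?_ measurable_const
  fun_prop

@[fun_prop]
lemma measurable_kernel {α : Type*} [MeasurableSpace α] (k : ℕ) {f g : α → ℝ}
    (hf : Measurable f) (hg : Measurable g) : Measurable fun a => KMonotone.kernel k (f a) (g a) :=
  (measurable_kernel_uncurry k).comp (hf.prodMk hg)

lemma kernel_nonneg {k : ℕ} {x θ : ℝ} (hx : 0 < x) : 0 ≤ kernel k x θ := by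
  unfold kernel
  split_ifs with h
  · have hθ : 0 < θ := hx.trans h
    have : 0 ≤ 1 - x / θ := by rw [sub_nonneg, div_le_one hθ]; exact h.le
    positivity
  · exact le_rfl

lemma kernel_le {k : ℕ} {x θ : ℝ} (hx : 0 < x) (hθ : 0 < θ) : kernel k x θ ≤ k / θ := by
  unfold kernel
  split_ifs with h
  · have h1 : 0 ≤ 1 - x / θ := by rw [sub_nonneg, div_le_one hθ]; exact h.le
    have h2 : 1 - x / θ ≤ 1 := sub_le_self _ (by positivity)
    exact mul_le_of_le_one_right (by positivity) (pow_le_one₀ h1 h2)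
  · positivity

/-- Rounding a support point up costs only a factor `θ' / θ` in the kernel. -/
lemma kernel_le_mul_kernel {k : ℕ} {x θ θ' : ℝ} (hx : 0 < x) (hθ : 0 < θ) (h : θ ≤ θ') :
    kernel k x θ ≤ θ' / θ * kernel k x θ' := by
  unfold kernel
  have hθ' : 0 < θ' := hθ.trans_le h
  split_ifs with h1 h2 h2
  · have h3 : 0 ≤ 1 - x / θ := by rw [sub_nonneg, div_le_one hθ]; exact h1.le
    have h4 : θ' / θ * (k / θ' * (1 - x / θ') ^ (k - 1)) = k / θ * (1 - x / θ') ^ (k - 1) := by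
      field_simp
    rw [h4]
    gcongr
  · exact absurd (h1.trans_le h) h2
  · have h3 : 0 ≤ 1 - x / θ' := by rw [sub_nonneg, div_le_one hθ']; exact h2.le
    positivity
  · simp

/-- Moving a support point down by less than `ρ` changes the kernel by a factor close to `1`,
except on a window of length `s ≫ ρ` to the left of the support point. -/
lemma mul_kernel_le_kernel {k : ℕ} {x θ θ₀ s ρ : ℝ} (hx : 0 < x) (hs : 0 < s) (hρs : ρ ≤ s)
    (hθ : θ₀ - ρ < θ) (hθ₀ : θ < θ₀) (hθp : 0 < θ) (hxw : x ∉ Set.Ioo (θ₀ - s) θ₀) :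
    (1 - k * (ρ / s)) * kernel k x θ₀ ≤ kernel k x θ := by
  by_cases hx0 : x < θ₀
  · have hx1 : x ≤ θ₀ - s := by
      by_contra hcon
      exact hxw ⟨not_le.1 hcon, hx0⟩
    have hxθ : x < θ := by linarith
    have hθ₀p : 0 < θ₀ := hθp.trans hθ₀
    have hρ : 0 < ρ := by linarith
    have hd : 0 < θ₀ - x := by linarith
    unfold kernel
    rw [if_pos hx0, if_pos hxθ]
    have hq : ρ / s ≤ 1 := by rw [div_le_one hs]; exact hρs
    have hq0 : 0 ≤ ρ / s := by positivity
    have hA : 0 ≤ 1 - x / θ₀ := by rw [sub_nonneg, div_le_one hθ₀p]; exact hx0.le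
    have hkey : (1 - ρ / s) * (1 - x / θ₀) ≤ 1 - x / θ := by
      have e1 : 1 - x / θ = (θ - x) / θ := by field_simp
      have e2 : 1 - x / θ₀ = (θ₀ - x) / θ₀ := by field_simp
      have h1 : (1 - ρ / s) * (θ₀ - x) ≤ θ - x := by
        have : ρ ≤ ρ / s * (θ₀ - x) := by
          rw [div_mul_eq_mul_div, le_div_iff₀ hs]
          nlinarith
        nlinarith
      rw [e1, e2, mul_div_assoc', div_le_div_iff₀ hθ₀p hθp]
      have h2 : 0 ≤ (1 - ρ / s) * (θ₀ - x) := mul_nonneg (by linarith) hd.le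
      calc (1 - ρ / s) * (θ₀ - x) * θ ≤ (1 - ρ / s) * (θ₀ - x) * θ₀ := by gcongr
        _ ≤ (θ - x) * θ₀ := by gcongr
    have hB : 1 - (k : ℝ) * (ρ / s) ≤ (1 - ρ / s) ^ (k - 1) := by
      have h1 := one_add_mul_le_pow (a := -(ρ / s)) (by linarith) (k - 1)
      have h2 : ((k - 1 : ℕ) : ℝ) ≤ k := by exact_mod_cast Nat.sub_le k 1
      have h3 : ((k - 1 : ℕ) : ℝ) * (ρ / s) ≤ k * (ρ / s) := by gcongr
      calc 1 - (k : ℝ) * (ρ / s) ≤ 1 + ((k - 1 : ℕ) : ℝ) * -(ρ / s) := by linarith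
        _ ≤ _ := by rw [sub_eq_add_neg]; exact h1
    calc (1 - k * (ρ / s)) * (k / θ₀ * (1 - x / θ₀) ^ (k - 1))
        ≤ (1 - ρ / s) ^ (k - 1) * (k / θ₀ * (1 - x / θ₀) ^ (k - 1)) := by
          gcongr
      _ = k / θ₀ * ((1 - ρ / s) * (1 - x / θ₀)) ^ (k - 1) := by rw [mul_pow]; ring
      _ ≤ k / θ * (1 - x / θ) ^ (k - 1) := by
          have : 0 ≤ (1 - ρ / s) * (1 - x / θ₀) := mul_nonneg (by linarith) hA
          gcongr
  · have : kernel k x θ₀ = 0 := by unfold kernel; rw [if_neg hx0]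
    rw [this, mul_zero]
    exact kernel_nonneg hx

lemma lintegral_kernel {k : ℕ} (hk : 1 ≤ k) {θ : ℝ} (hθ : 0 < θ) (hθ1 : θ ≤ 1) :
    ∫⁻ x in Set.Ioo 0 1, ENNReal.ofReal (kernel k x θ) = 1 := by
  have h1 : ∫⁻ x in Set.Ioo 0 1, ENNReal.ofReal (kernel k x θ)
      = ∫⁻ x in Set.Ioc 0 θ, ENNReal.ofReal ((k : ℝ) / θ * (1 - x / θ) ^ (k - 1)) := by
    rw [← restrict_Ioo_eq_restrict_Ioc, ← lintegral_indicator measurableSet_Ioo,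
      ← lintegral_indicator measurableSet_Ioo]
    congr 1
    ext x
    unfold kernel
    by_cases hx : x ∈ Set.Ioo 0 θ
    · have hx' : x ∈ Set.Ioo (0 : ℝ) 1 := ⟨hx.1, hx.2.trans_le hθ1⟩
      rw [Set.indicator_of_mem hx, Set.indicator_of_mem hx', if_pos hx.2]
    · rw [Set.indicator_of_notMem hx]
      by_cases hx' : x ∈ Set.Ioo (0 : ℝ) 1
      · rw [Set.indicator_of_mem hx', if_neg (fun h => hx ⟨hx'.1, h⟩), ENNReal.ofReal_zero]
      · rw [Set.indicator_of_notMem hx']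
  have hcont : Continuous fun x : ℝ => (k : ℝ) / θ * (1 - x / θ) ^ (k - 1) := by fun_prop
  rw [h1, ← ofReal_integral_eq_lintegral_ofReal
    ((hcont.continuousOn.integrableOn_Icc (a := 0) (b := θ)).mono_set Set.Ioc_subset_Icc_self),
    ← intervalIntegral.integral_of_le hθ.le]
  · have h2 : ∫ x in (0 : ℝ)..θ, (k : ℝ) / θ * (1 - x / θ) ^ (k - 1)
        = -(1 - θ / θ) ^ k - -(1 - 0 / θ) ^ k := by
      refine intervalIntegral.integral_eq_sub_of_hasDerivAt (f := fun x => -(1 - x / θ) ^ k)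
        (fun x _ => ?_) (hcont.intervalIntegrable _ _)
      have := (((hasDerivAt_id x).div_const θ).const_sub 1).pow k |>.neg
      refine this.congr_deriv ?_
      simp only [id]
      ring
    rw [h2, div_self hθ.ne', sub_self, zero_pow (by omega)]
    simp
  · filter_upwards [ae_restrict_mem measurableSet_Ioc] with x hx
    have : 0 ≤ 1 - x / θ := by rw [sub_nonneg, div_le_one hθ]; exact hx.2
    simp only [Pi.zero_apply]
    positivity

@[fun_prop]
lemma measurable_mixDensity_comp {α : Type*} [MeasurableSpace α] {k J : ℕ}
    {β : α → Fin (k + 1) → ℝ} {w θ : α → Fin J → ℝ} {x : α → ℝ} (hβ : Measurable β)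
    (hw : Measurable w) (hθ : Measurable θ) (hx : Measurable x) :
    Measurable fun a => KMonotone.mixDensity k J (β a) (w a) (θ a) (x a) := by
  unfold KMonotone.mixDensity
  fun_prop

lemma measurable_mixDensity (k J : ℕ) (β : Fin (k + 1) → ℝ) (w θ : Fin J → ℝ) :
    Measurable (mixDensity k J β w θ) :=
  measurable_mixDensity_comp (x := id) (β := fun _ => β) measurable_const measurable_const
    measurable_const measurable_id

lemma mixDensity_nonneg {k J : ℕ} {β : Fin (k + 1) → ℝ} {w θ : Fin J → ℝ} {x : ℝ}
    (hβ : ∀ j, 0 ≤ β j) (hw : ∀ l, 0 ≤ w l) (hx : 0 < x) : 0 ≤ mixDensity k J β w θ x :=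
  add_nonneg (Finset.sum_nonneg fun _ _ => mul_nonneg (hβ _) (kernel_nonneg hx))
    (mul_nonneg (hβ _) (Finset.sum_nonneg fun _ _ => mul_nonneg (hw _) (kernel_nonneg hx)))

lemma lintegral_mixDensity {k J : ℕ} (hk : 1 ≤ k) {β : Fin (k + 1) → ℝ} {w θ : Fin J → ℝ}
    (hβ : ∀ j, 0 ≤ β j) (hw : ∀ l, 0 ≤ w l) (hθ : ∀ l, 0 < θ l ∧ θ l ≤ 1) :
    ∫⁻ x in Set.Ioo 0 1, ENNReal.ofReal (mixDensity k J β w θ x)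
      = ENNReal.ofReal (∑ j : Fin k, β j.castSucc + β (Fin.last k) * ∑ l, w l) := by
  have h1 : ∫⁻ x in Set.Ioo 0 1, ENNReal.ofReal (mixDensity k J β w θ x)
      = ∫⁻ x in Set.Ioo 0 1,
        (∑ j : Fin k, ENNReal.ofReal (β j.castSucc) * ENNReal.ofReal (kernel (j + 1) x 1)
        + ENNReal.ofReal (β (Fin.last k)) *
          ∑ l : Fin J, ENNReal.ofReal (w l) * ENNReal.ofReal (kernel k x (θ l))) := by
    refine setLIntegral_congr_fun measurableSet_Ioo fun x hx => ?_
    have hx0 : 0 < x := hx.1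
    simp only [mixDensity]
    rw [ENNReal.ofReal_add (Finset.sum_nonneg fun j _ => mul_nonneg (hβ _) (kernel_nonneg hx0))
      (mul_nonneg (hβ _) (Finset.sum_nonneg fun _ _ => mul_nonneg (hw _) (kernel_nonneg hx0))),
      ENNReal.ofReal_sum_of_nonneg fun j _ => mul_nonneg (hβ _) (kernel_nonneg hx0),
      ENNReal.ofReal_mul (hβ _),
      ENNReal.ofReal_sum_of_nonneg fun j _ => mul_nonneg (hw _) (kernel_nonneg hx0)]
    simp only [ENNReal.ofReal_mul (hβ _), ENNReal.ofReal_mul (hw _)]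
  rw [h1, lintegral_add_left (by fun_prop), lintegral_finsetSum _ (fun _ _ => by fun_prop),
    lintegral_const_mul _ (by fun_prop), lintegral_finsetSum _ (fun _ _ => by fun_prop)]
  have h2 : ∀ j : Fin k, ∫⁻ x in Set.Ioo 0 1,
      ENNReal.ofReal (β j.castSucc) * ENNReal.ofReal (kernel (j + 1) x 1)
      = ENNReal.ofReal (β j.castSucc) := fun j => by
    rw [lintegral_const_mul _ (by fun_prop), lintegral_kernel (by omega) one_pos le_rfl, mul_one]
  have h3 : ∀ l : Fin J, ∫⁻ x in Set.Ioo 0 1,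
      ENNReal.ofReal (w l) * ENNReal.ofReal (kernel k x (θ l)) = ENNReal.ofReal (w l) := fun l => by
    rw [lintegral_const_mul _ (by fun_prop), lintegral_kernel hk (hθ l).1 (hθ l).2, mul_one]
  simp only [h2, h3]
  rw [ENNReal.ofReal_add (Finset.sum_nonneg fun j _ => hβ _)
      (mul_nonneg (hβ _) (Finset.sum_nonneg fun _ _ => hw _)),
      ENNReal.ofReal_sum_of_nonneg fun j _ => hβ _, ENNReal.ofReal_mul (hβ _),
      ENNReal.ofReal_sum_of_nonneg fun j _ => hw _]

lemma lintegral_mixDensity_eq_one {k J : ℕ} (hk : 1 ≤ k) {β : Fin (k + 1) → ℝ} {w θ : Fin J → ℝ}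
    (hβ : β ∈ stdSimplex ℝ (Fin (k + 1))) (hw : w ∈ stdSimplex ℝ (Fin J))
    (hθ : ∀ l, 0 < θ l ∧ θ l ≤ 1) :
    ∫⁻ x in Set.Ioo 0 1, ENNReal.ofReal (mixDensity k J β w θ x) = 1 := by
  rw [lintegral_mixDensity hk hβ.1 hw.1 hθ, hw.2, mul_one, ← Fin.sum_univ_castSucc, hβ.2,
    ENNReal.ofReal_one]

lemma mixDensity_le {k J : ℕ} {β : Fin (k + 1) → ℝ} {w θ : Fin J → ℝ} {x δ : ℝ}
    (hβ : β ∈ stdSimplex ℝ (Fin (k + 1))) (hw : w ∈ stdSimplex ℝ (Fin J)) (hδ : 0 < δ)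
    (hδ1 : δ ≤ 1) (hθ : ∀ l, δ ≤ θ l) (hx : 0 < x) : mixDensity k J β w θ x ≤ k / δ := by
  have h1 : ∀ j : Fin k, kernel (j + 1) x 1 ≤ k / δ := fun j => by
    refine (kernel_le hx one_pos).trans ?_
    have : ((j + 1 : ℕ) : ℝ) ≤ k := by exact_mod_cast j.2
    gcongr
  have h2 : ∀ l, kernel k x (θ l) ≤ k / δ := fun l =>
    (kernel_le hx (hδ.trans_le (hθ l))).trans (by gcongr; exact hθ l)
  calc mixDensity k J β w θ x
      ≤ ∑ j : Fin k, β j.castSucc * (k / δ) + β (Fin.last k) * ∑ l, w l * (k / δ) := by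
        unfold mixDensity
        gcongr with j _ l _
        · exact hβ.1 _
        · exact h1 j
        · exact hβ.1 _
        · exact hw.1 _
        · exact h2 l
    _ = k / δ := by
        rw [← Finset.sum_mul, ← Finset.sum_mul, hw.2, one_mul, ← add_mul,
          ← Fin.sum_univ_castSucc, hβ.2, one_mul]

/-! ### Dirichlet distributions -/

lemma exists_inv_pow_le {c : ℝ} (hc : 0 < c) :
    ∃ D : ℕ, ∀ n : ℕ, 2 ≤ n → ((n : ℝ) ^ D)⁻¹ ≤ c := by
  obtain ⟨D, hD⟩ := pow_unbounded_of_one_lt c⁻¹ (one_lt_two (α := ℝ))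
  refine ⟨D, fun n hn => inv_le_of_inv_le₀ hc (hD.le.trans ?_)⟩
  have : (2 : ℝ) ≤ n := by exact_mod_cast hn
  gcongr

lemma ofReal_inv_pow {n : ℕ} (hn : 2 ≤ n) (D : ℕ) :
    ENNReal.ofReal (((n : ℝ) ^ D)⁻¹) = ((n : ℝ≥0∞) ^ D)⁻¹ := by
  have : (0 : ℝ) < n := by exact_mod_cast (by omega : 0 < n)
  rw [ENNReal.ofReal_inv_of_pos (by positivity), ENNReal.ofReal_pow this.le,
    ENNReal.ofReal_natCast]

lemma ae_gammaMeasure_pos (α : ℝ) : ∀ᵐ y ∂gammaMeasure α 1, 0 < y := by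
  rw [ae_iff]
  have : {y : ℝ | ¬ 0 < y} = Set.Iic 0 := by ext; simp
  rw [this, gammaMeasure, withDensity_apply _ measurableSet_Iic,
    ← setLIntegral_congr Iio_ae_eq_Iic]
  exact lintegral_gammaPDF_of_nonpos le_rfl

lemma measurable_normalize {ι : Type} [Fintype ι] :
    Measurable fun (y : ι → ℝ) i => y i / ∑ j, y j := by fun_prop

lemma isProbabilityMeasure_dirichlet {ι : Type} [Fintype ι] {α : ι → ℝ} (hα : ∀ i, 0 < α i) :
    IsProbabilityMeasure (dirichlet α) := by
  have := fun i => isProbabilityMeasure_gammaMeasure (hα i) one_pos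
  exact Measure.isProbabilityMeasure_map measurable_normalize.aemeasurable

lemma ae_dirichlet {ι : Type} [Fintype ι] [Nonempty ι] {α : ι → ℝ} (hα : ∀ i, 0 < α i) :
    ∀ᵐ β ∂dirichlet α, (∀ i, 0 < β i) ∧ ∑ i, β i = 1 := by
  have := fun i => isProbabilityMeasure_gammaMeasure (hα i) one_pos
  have hm : MeasurableSet {β : ι → ℝ | (∀ i, 0 < β i) ∧ ∑ i, β i = 1} := by
    rw [show {β : ι → ℝ | (∀ i, 0 < β i) ∧ ∑ i, β i = 1}
      = (⋂ i, {β | 0 < β i}) ∩ {β | ∑ i, β i = 1} by ext; simp]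
    exact (MeasurableSet.iInter fun i =>
      measurableSet_lt measurable_const (measurable_pi_apply i)).inter
        (measurableSet_eq_fun (by fun_prop) measurable_const)
  rw [dirichlet, ae_map_iff measurable_normalize.aemeasurable hm]
  have h : ∀ᵐ y ∂Measure.pi fun i => gammaMeasure (α i) 1, ∀ i, 0 < y i :=
    ae_all_iff.2 fun i => Measure.tendsto_eval_ae_ae.eventually (ae_gammaMeasure_pos (α i))
  filter_upwards [h] with y hy
  have hs : 0 < ∑ j, y j := Finset.sum_pos (fun j _ => hy j) Finset.univ_nonempty
  exact ⟨fun i => div_pos (hy i) hs, by rw [← Finset.sum_div, div_self hs.ne']⟩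

/-- A gamma distribution gives `[b + τ / 2, b + τ]` with `b, τ ∈ [0, 1]` a mass of at least a
constant times a power of `τ`, uniformly over shape parameters in a compact subset of `(0, ∞)`. -/
lemma exists_gammaMeasure_Icc_ge {lo hi : ℝ} (hlo : 0 < lo) :
    ∃ c : ℝ, 0 < c ∧ ∃ h : ℕ, ∀ α, lo ≤ α → α ≤ hi → ∀ b τ : ℝ, 0 ≤ b → b ≤ 1 → 0 < τ → τ ≤ 1 →
      ENNReal.ofReal (c * (τ / 2) ^ h) ≤ gammaMeasure α 1 (Set.Icc (b + τ / 2) (b + τ)) := by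
  obtain ⟨G, hG⟩ := (isCompact_Icc (a := lo) (b := hi)).exists_bound_of_continuousOn
    (f := Real.Gamma) fun α hα => (Real.differentiableAt_Gamma fun m => by
      have : (0 : ℝ) ≤ m := m.cast_nonneg
      linarith [hα.1]).continuousAt.continuousWithinAt
  have hGp : 0 < max G 1 := by positivity
  refine ⟨(max G 1)⁻¹ * (1 / 2) * Real.exp (-2), by positivity, ⌈hi⌉₊ + 1,
    fun α h1 h2 b τ hb hb1 hτ hτ1 => ?_⟩
  have hα : 0 < α := hlo.trans_le h1
  rw [gammaMeasure, withDensity_apply _ measurableSet_Icc]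
  have hpt : ∀ x ∈ Set.Icc (b + τ / 2) (b + τ),
      ENNReal.ofReal ((max G 1)⁻¹ * (1 / 2) * Real.exp (-2) * (τ / 2) ^ ⌈hi⌉₊)
        ≤ gammaPDF α 1 x := by
    rintro x ⟨hx1, hx2⟩
    have hx : 0 < x := by linarith
    have hx2' : x ≤ 2 := by linarith
    rw [gammaPDF_of_nonneg hx.le]
    refine ENNReal.ofReal_le_ofReal ?_
    have hΓ : (max G 1)⁻¹ ≤ (Real.Gamma α)⁻¹ := by
      have h3 := hG α ⟨h1, h2⟩
      have h4 := Real.Gamma_pos_of_pos hα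
      rw [Real.norm_of_nonneg h4.le] at h3
      exact inv_anti₀ h4 (h3.trans (le_max_left _ _))
    have hpow : (τ / 2) ^ ⌈hi⌉₊ * (1 / 2) ≤ x ^ (α - 1) := by
      rw [Real.rpow_sub hx, Real.rpow_one, div_eq_mul_one_div (x ^ α)]
      have : (τ / 2) ^ ⌈hi⌉₊ ≤ x ^ α := by
        rw [← Real.rpow_natCast]
        calc (τ / 2) ^ (⌈hi⌉₊ : ℝ) ≤ (τ / 2) ^ α :=
              Real.rpow_le_rpow_of_exponent_ge (by positivity) (by linarith)
                (h2.trans (Nat.le_ceil hi))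
          _ ≤ x ^ α := Real.rpow_le_rpow (by positivity) (by linarith) hα.le
      have h3 : 1 / 2 ≤ 1 / x := one_div_le_one_div_of_le hx hx2'
      exact mul_le_mul this h3 (by norm_num) (by positivity)
    have hexp : Real.exp (-2) ≤ Real.exp (-(1 * x)) := Real.exp_le_exp.2 (by linarith)
    rw [Real.one_rpow, one_div (Real.Gamma α)]
    calc _ = (max G 1)⁻¹ * ((τ / 2) ^ ⌈hi⌉₊ * (1 / 2)) * Real.exp (-2) := by ring
      _ ≤ _ := by gcongr
  calc _ = ENNReal.ofReal ((max G 1)⁻¹ * (1 / 2) * Real.exp (-2) * (τ / 2) ^ ⌈hi⌉₊)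
        * volume (Set.Icc (b + τ / 2) (b + τ)) := by
        rw [Real.volume_Icc, ← ENNReal.ofReal_mul (by positivity)]
        congr 1
        ring
    _ ≤ _ := by
        rw [← setLIntegral_const]
        exact setLIntegral_mono' measurableSet_Icc hpt

/-- Prior mass of a one-sided multiplicative neighbourhood of a point of the simplex: it is at least
`n ^ (-D K)` in dimension `K`. If the gamma variables satisfy `Y_j ∈ [b_j, b_j + 1 / (n K)]`, then
their sum is at most `1 + 1 / n`. -/
lemma exists_dirichlet_ge {lo hi : ℝ} (hlo : 0 < lo) :
    ∃ D : ℕ, ∀ n : ℕ, 2 ≤ n → ∀ K : ℕ, 1 ≤ K → K ≤ n + 1 → ∀ α : Fin K → ℝ,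
      (∀ j, lo ≤ α j ∧ α j ≤ hi) → ∀ b ∈ stdSimplex ℝ (Fin K),
      ((n : ℝ≥0∞) ^ (D * K))⁻¹ ≤ dirichlet α {y | ∀ j, (1 - 1 / (n : ℝ)) * b j ≤ y j} := by
  obtain ⟨c, hc, h, H⟩ := exists_gammaMeasure_Icc_ge (hi := hi) hlo
  obtain ⟨D, hD⟩ := exists_inv_pow_le hc
  refine ⟨D + 4 * h, fun n hn K hK hKn α hα b hb => ?_⟩
  have := fun j => isProbabilityMeasure_gammaMeasure (hlo.trans_le (hα j).1) one_pos
  have hn' : (2 : ℝ) ≤ n := by exact_mod_cast hn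
  have hK' : (1 : ℝ) ≤ K := by exact_mod_cast hK
  have hKn' : (K : ℝ) ≤ n + 1 := by exact_mod_cast hKn
  set τ : ℝ := 1 / (n * K) with hτ
  have hτ0 : 0 < τ := by positivity
  have hnK : (1 : ℝ) ≤ n * K := by nlinarith
  have hτ1 : τ ≤ 1 := by rw [hτ, div_le_one (by positivity)]; exact hnK
  have hτn : ((n : ℝ) ^ 4)⁻¹ ≤ τ / 2 := by
    rw [hτ, div_div, ← one_div]
    refine one_div_le_one_div_of_le (by positivity) ?_
    have e1 : (n : ℝ) * K * 2 ≤ n * (n + 1) * 2 := by gcongr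
    have e2 : (n : ℝ) + 1 ≤ n * n := by nlinarith
    have e3 : (n : ℝ) * (n + 1) * 2 ≤ n * (n * n) * n := by gcongr
    calc (n : ℝ) * K * 2 ≤ n * (n * n) * n := e1.trans e3
      _ = n ^ 4 := by ring
  have hsub : (Set.univ.pi fun j => Set.Icc (b j + τ / 2) (b j + τ)) ⊆
      (fun (y : Fin K → ℝ) i => y i / ∑ j, y j) ⁻¹'
        {y | ∀ j, (1 - 1 / (n : ℝ)) * b j ≤ y j} := by
    intro y hy j
    simp only [Set.mem_pi, Set.mem_univ, true_implies, Set.mem_Icc] at hy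
    have hb0 := fun j => hb.1 j
    have hs : 0 < ∑ j, y j := Finset.sum_pos (fun j _ => by linarith [(hy j).1, hb0 j])
      ⟨⟨0, hK⟩, Finset.mem_univ _⟩
    have hs1 : ∑ j, y j ≤ 1 + 1 / n := by
      calc ∑ j, y j ≤ ∑ j, (b j + τ) := Finset.sum_le_sum fun j _ => (hy j).2
        _ = 1 + 1 / n := by
          rw [Finset.sum_add_distrib, hb.2, Finset.sum_const, Finset.card_univ, Fintype.card_fin,
            nsmul_eq_mul, hτ]
          field_simp
    simp only
    rw [le_div_iff₀ hs]
    have hq : 0 ≤ 1 - 1 / (n : ℝ) := by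
      rw [sub_nonneg, div_le_one (by positivity)]; linarith
    calc (1 - 1 / (n : ℝ)) * b j * ∑ j, y j ≤ (1 - 1 / (n : ℝ)) * b j * (1 + 1 / n) :=
          mul_le_mul_of_nonneg_left hs1 (mul_nonneg hq (hb0 j))
      _ = b j - (1 / n) ^ 2 * b j := by ring
      _ ≤ y j := by
          have := (hy j).1
          have : 0 ≤ (1 / (n : ℝ)) ^ 2 * b j := mul_nonneg (by positivity) (hb0 j)
          linarith
  refine le_trans ?_ (Measure.le_map_apply measurable_normalize.aemeasurable _)
  refine le_trans ?_ (measure_mono hsub)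
  rw [Measure.pi_pi]
  calc ((n : ℝ≥0∞) ^ ((D + 4 * h) * K))⁻¹
      = ∏ _j : Fin K, ((n : ℝ≥0∞) ^ (D + 4 * h))⁻¹ := by
        rw [Finset.prod_const, Finset.card_univ, Fintype.card_fin, pow_mul, ENNReal.inv_pow]
    _ ≤ _ := by
        refine Finset.prod_le_prod' fun j _ => ?_
        have hb1 : b j ≤ 1 := by
          rw [← hb.2]
          exact Finset.single_le_sum (fun i _ => hb.1 i) (Finset.mem_univ j)
        refine le_trans ?_ (H (α j) (hα j).1 (hα j).2 (b j) τ (hb.1 j) hb1 hτ0 hτ1)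
        rw [← ofReal_inv_pow hn]
        refine ENNReal.ofReal_le_ofReal ?_
        rw [pow_add, pow_mul, mul_inv, ← inv_pow ((n : ℝ) ^ 4)]
        have := hD n hn
        gcongr

/-! ### Geometric weights -/

lemma geomWeight_succ {n : ℕ} (hn : 2 ≤ n) (s : ℝ) (m : ℕ) :
    geomWeight n s (m + 1)
      = ENNReal.ofReal ((1 - (n : ℝ) ^ (-s)) * ((n : ℝ) ^ (-s)) ^ m) := by
  have hn0 : (0 : ℝ) < n := by exact_mod_cast (by omega : 0 < n)
  rw [geomWeight, if_pos (by omega)]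
  congr 1
  have h1 : (n : ℝ) ^ (-(s * ((m + 1 : ℕ) : ℝ))) = (n : ℝ) ^ (-s) * ((n : ℝ) ^ (-s)) ^ m := by
    rw [← Real.rpow_natCast, ← Real.rpow_mul hn0.le, ← Real.rpow_add hn0]
    congr 1
    push_cast
    ring
  have h2 : (n : ℝ) ^ s * (n : ℝ) ^ (-s) = 1 := by
    rw [← Real.rpow_add hn0, add_neg_cancel, Real.rpow_zero]
  rw [h1]
  linear_combination ((n : ℝ) ^ (-s)) ^ m * h2

lemma rpow_neg_lt_one {n : ℕ} (hn : 2 ≤ n) {s : ℝ} (hs : 0 < s) : (n : ℝ) ^ (-s) < 1 :=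
  Real.rpow_lt_one_of_one_lt_of_neg (by exact_mod_cast (by omega : 1 < n)) (by linarith)

lemma tsum_geomWeight {n : ℕ} (hn : 2 ≤ n) {s : ℝ} (hs : 0 < s) :
    ∑' m, geomWeight n s m = 1 := by
  have hq := rpow_neg_lt_one hn hs
  have hq0 : (0 : ℝ) ≤ (n : ℝ) ^ (-s) := by positivity
  rw [tsum_eq_zero_add' ENNReal.summable]
  simp only [geomWeight_succ hn]
  have h0 : geomWeight n s 0 = 0 := by simp [geomWeight]
  rw [h0, zero_add, ← ENNReal.ofReal_tsum_of_nonneg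
    (fun m => mul_nonneg (by linarith) (by positivity))
    ((summable_geometric_of_lt_one hq0 hq).mul_left _), tsum_mul_left,
    tsum_geometric_of_lt_one hq0 hq, mul_inv_cancel₀ (by linarith), ENNReal.ofReal_one]

lemma tsum_geomWeight_tail {n : ℕ} (hn : 2 ≤ n) {s : ℝ} (hs : 0 < s) (K : ℕ) :
    ∑' m, (if K < m then geomWeight n s m else 0) = ENNReal.ofReal (((n : ℝ) ^ (-s)) ^ K) := by
  have hq0 : (0 : ℝ) ≤ (n : ℝ) ^ (-s) := by positivity
  rw [← Summable.sum_add_tsum_nat_add' (k := K) ENNReal.summable,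
    Finset.sum_eq_zero fun m hm => if_neg (by have := Finset.mem_range.1 hm; omega), zero_add]
  have : ∀ m, (if K < m + K then geomWeight n s (m + K) else 0)
      = ENNReal.ofReal (((n : ℝ) ^ (-s)) ^ K) * geomWeight n s m := by
    rintro (_ | m)
    · simp [geomWeight]
    · rw [if_pos (by omega), show m + 1 + K = (m + K) + 1 by ring, geomWeight_succ hn,
        geomWeight_succ hn, ← ENNReal.ofReal_mul (by positivity)]
      congr 1
      ring
  simp only [this]
  rw [ENNReal.tsum_mul_left, tsum_geomWeight hn hs, mul_one]

lemma exists_geomWeight_ge {s : ℝ} (hs : 0 < s) :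
    ∃ D : ℕ, ∀ n : ℕ, 2 ≤ n → ∀ m : ℕ, 1 ≤ m → ((n : ℝ≥0∞) ^ (D * m))⁻¹ ≤ geomWeight n s m := by
  obtain ⟨D, hD⟩ := exists_inv_pow_le (c := 1 - (2 : ℝ) ^ (-s))
    (by have := rpow_neg_lt_one le_rfl hs; push_cast at this; linarith)
  refine ⟨D + ⌈s⌉₊, fun n hn m hm => ?_⟩
  obtain ⟨m, rfl⟩ : ∃ m', m = m' + 1 := ⟨m - 1, by omega⟩
  have hn' : (2 : ℝ) ≤ n := by exact_mod_cast hn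
  rw [geomWeight_succ hn, ← ofReal_inv_pow hn]
  refine ENNReal.ofReal_le_ofReal ?_
  have h1 : 1 - (2 : ℝ) ^ (-s) ≤ 1 - (n : ℝ) ^ (-s) := by
    have := Real.rpow_le_rpow_of_nonpos (by norm_num) hn' (by linarith : -s ≤ 0)
    linarith
  have h2 : ((n : ℝ) ^ ⌈s⌉₊)⁻¹ ≤ (n : ℝ) ^ (-s) := by
    rw [← Real.rpow_natCast, ← Real.rpow_neg (by positivity)]
    exact Real.rpow_le_rpow_of_exponent_le (by linarith) (neg_le_neg (Nat.le_ceil s))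
  calc ((n : ℝ) ^ ((D + ⌈s⌉₊) * (m + 1)))⁻¹
      ≤ ((n : ℝ) ^ (D + ⌈s⌉₊ * m))⁻¹ := by
        refine inv_anti₀ (by positivity) (pow_le_pow_right₀ (by linarith) ?_)
        nlinarith [Nat.zero_le (D * m), Nat.zero_le ⌈s⌉₊]
    _ = ((n : ℝ) ^ D)⁻¹ * (((n : ℝ) ^ ⌈s⌉₊)⁻¹) ^ m := by rw [pow_add, pow_mul, mul_inv, inv_pow]
    _ ≤ _ := by
        have h3 := (hD n hn).trans h1
        have h4 : 0 < ((n : ℝ) ^ D)⁻¹ := by positivity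
        gcongr
        exact h4.le.trans h3

/-! ### The prior -/

/-- The parameters `(β, w, θ)` for given `(k, J) = m`. -/
abbrev LayerParam (m : ℕ × ℕ) : Type :=
  (Fin (m.1 + 1) → ℝ) × (Fin m.2 → ℝ) × (Fin m.2 → ℝ)

lemma measurable_of_sigma {α : Type*} [MeasurableSpace α] {f : Param → α}
    (hf : ∀ m, Measurable fun p : LayerParam m => f ⟨m, p⟩) : Measurable f := fun s hs => by
  rw [Sigma.instMeasurableSpace, MeasurableSpace.measurableSet_iInf]
  exact fun m => hf m hs

lemma measurable_sigmaMk (m : ℕ × ℕ) :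
    Measurable (Sigma.mk m : LayerParam m → Param) := fun s hs => by
  rw [Sigma.instMeasurableSpace, MeasurableSpace.measurableSet_iInf] at hs
  exact hs m

lemma measurableEmbedding_sigmaMk (m : ℕ × ℕ) :
    MeasurableEmbedding (Sigma.mk m : LayerParam m → Param) where
  injective := sigma_mk_injective
  measurable := measurable_sigmaMk m
  measurableSet_image' := fun s hs => by
    rw [Sigma.instMeasurableSpace, MeasurableSpace.measurableSet_iInf]
    intro m'
    change MeasurableSet ((Sigma.mk m' : LayerParam m' → Param) ⁻¹' (Sigma.mk m '' s))
    by_cases h : m = m'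
    · subst h
      rwa [Set.preimage_image_eq _ sigma_mk_injective]
    · rw [Set.preimage_image_sigmaMk_of_ne (Ne.symm h)]
      exact MeasurableSet.empty

/-- The conditional prior of `(β, w, θ)` given `(k, J) = m`. -/
noncomputable def layer (a : (k : ℕ) → Fin (k + 1) → ℝ) (ω : (J : ℕ) → Fin J → ℝ) (H : Measure ℝ)
    (m : ℕ × ℕ) : Measure (LayerParam m) :=
  (dirichlet (a m.1)).prod ((dirichlet (ω m.2)).prod (Measure.pi fun _ : Fin m.2 => H))

/-- The parameters whose density is a genuine mixture: the weights lie in the simplices, with all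
coordinates of `β` positive, and the support points lie in `(0, 1)`. -/
structure Param.Admissible (ξ : Param) : Prop where
  one_le_k : 1 ≤ ξ.1.1
  one_le_J : 1 ≤ ξ.1.2
  pos : ∀ j, 0 < ξ.2.1 j
  mem_simplex : ξ.2.1 ∈ stdSimplex ℝ (Fin (ξ.1.1 + 1))
  mem_simplex' : ξ.2.2.1 ∈ stdSimplex ℝ (Fin ξ.1.2)
  mem_Ioo : ∀ l, ξ.2.2.2 l ∈ Set.Ioo (0 : ℝ) 1

lemma Param.Admissible.density_nonneg {ξ : Param} (h : ξ.Admissible) {x : ℝ} (hx : 0 < x) :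
    0 ≤ ξ.density x :=
  mixDensity_nonneg h.mem_simplex.1 h.mem_simplex'.1 hx

lemma Param.Admissible.density_pos {ξ : Param} (h : ξ.Admissible) {x : ℝ}
    (hx : x ∈ Set.Ioo (0 : ℝ) 1) : 0 < ξ.density x := by
  refine add_pos_of_pos_of_nonneg ?_ (mul_nonneg (h.pos _).le
    (Finset.sum_nonneg fun l _ => mul_nonneg (h.mem_simplex'.1 l) (kernel_nonneg hx.1)))
  refine Finset.sum_pos (fun j _ => mul_pos (h.pos _) ?_) ⟨⟨0, h.one_le_k⟩, Finset.mem_univ _⟩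
  rw [kernel, if_pos hx.2]
  have : 0 < 1 - x / 1 := by rw [div_one]; linarith [hx.2]
  positivity

lemma Param.Admissible.lintegral_density {ξ : Param} (h : ξ.Admissible) :
    ∫⁻ x in Set.Ioo 0 1, ENNReal.ofReal (ξ.density x) = 1 :=
  lintegral_mixDensity_eq_one h.one_le_k h.mem_simplex h.mem_simplex'
    fun l => ⟨(h.mem_Ioo l).1, (h.mem_Ioo l).2.le⟩

lemma measurable_density (ξ : Param) : Measurable ξ.density := measurable_mixDensity _ _ _ _ _

/-- The parameters with at most `K` components of either kind and support points at least `δ`. -/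
def sieve (K : ℕ) (δ : ℝ) : Set Param :=
  {ξ | ξ.1.1 ≤ K ∧ ξ.1.2 ≤ K ∧ ∀ l, δ ≤ ξ.2.2.2 l}

lemma measurableSet_sieve (K : ℕ) (δ : ℝ) : MeasurableSet (sieve K δ) := by
  rw [Sigma.instMeasurableSpace, MeasurableSpace.measurableSet_iInf]
  intro m
  change MeasurableSet ((Sigma.mk m : LayerParam m → Param) ⁻¹' sieve K δ)
  by_cases h : m.1 ≤ K ∧ m.2 ≤ K
  · have : ((Sigma.mk m : LayerParam m → Param) ⁻¹' sieve K δ) = ⋂ l, {p | δ ≤ p.2.2 l} := by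
      ext p
      simp [sieve, h]
    rw [this]
    exact MeasurableSet.iInter fun l => measurableSet_le measurable_const (by fun_prop)
  · have : ((Sigma.mk m : LayerParam m → Param) ⁻¹' sieve K δ) = ∅ := by
      ext p
      simp only [sieve, Set.mem_preimage, Set.mem_ofPred_eq, Set.mem_empty_iff_false, iff_false]
      exact fun hp => h ⟨hp.1, hp.2.1⟩
    rw [this]
    exact MeasurableSet.empty

section Prior

variable {n : ℕ} {r c : ℝ} {a : (k : ℕ) → Fin (k + 1) → ℝ} {ω : (J : ℕ) → Fin J → ℝ}
  {H : Measure ℝ}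

lemma lintegral_prior {f : Param → ℝ≥0∞} (hf : Measurable f) :
    ∫⁻ ξ, f ξ ∂prior n r c a ω H
      = ∑' m : ℕ × ℕ, geomWeight n r m.1 * geomWeight n c m.2 *
        ∫⁻ p, f ⟨m, p⟩ ∂layer a ω H m := by
  rw [prior, lintegral_sum_measure]
  refine tsum_congr fun m => ?_
  rw [lintegral_smul_measure, lintegral_map hf (measurable_sigmaMk m), smul_eq_mul]
  rfl

lemma prior_apply {S : Set Param} (hS : MeasurableSet S) :
    prior n r c a ω H S
      = ∑' m : ℕ × ℕ, geomWeight n r m.1 * geomWeight n c m.2 *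
        layer a ω H m ((Sigma.mk m : LayerParam m → Param) ⁻¹' S) := by
  rw [prior, Measure.sum_apply _ hS]
  refine tsum_congr fun m => ?_
  rw [Measure.smul_apply, Measure.map_apply (measurable_sigmaMk m) hS, smul_eq_mul]
  rfl

lemma geomWeight_mul_eq_zero {m : ℕ × ℕ} (hm : ¬(1 ≤ m.1 ∧ 1 ≤ m.2)) :
    geomWeight n r m.1 * geomWeight n c m.2 = 0 := by
  rw [mul_eq_zero]
  by_contra! h
  exact hm ⟨by_contra fun h1 => h.1 (if_neg h1), by_contra fun h1 => h.2 (if_neg h1)⟩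

lemma tsum_geomWeight_mul {f g : ℕ → ℝ≥0∞} :
    ∑' m : ℕ × ℕ, f m.1 * g m.2 = (∑' k, f k) * ∑' J, g J := by
  rw [ENNReal.tsum_prod (f := fun k J => f k * g J)]
  simp only [ENNReal.tsum_mul_left, ENNReal.tsum_mul_right]

lemma isProbabilityMeasure_layer (ha : ∀ k, 1 ≤ k → ∀ j, 0 < a k j) (hω : ∀ J j, 0 < ω J j)
    [IsProbabilityMeasure H] {m : ℕ × ℕ} (hm : 1 ≤ m.1) :
    IsProbabilityMeasure (layer a ω H m) := by
  have := isProbabilityMeasure_dirichlet (ha m.1 hm)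
  have := isProbabilityMeasure_dirichlet (hω m.2)
  unfold layer
  infer_instance

lemma ae_layer (ha : ∀ k, 1 ≤ k → ∀ j, 0 < a k j) (hω : ∀ J j, 0 < ω J j)
    [IsProbabilityMeasure H] (hH : ∀ᵐ θ ∂H, θ ∈ Set.Ioo (0 : ℝ) 1) {m : ℕ × ℕ}
    (hm : 1 ≤ m.1 ∧ 1 ≤ m.2) :
    ∀ᵐ p ∂layer a ω H m, Param.Admissible ⟨m, p⟩ := by
  have := isProbabilityMeasure_dirichlet (ha m.1 hm.1)
  have := isProbabilityMeasure_dirichlet (hω m.2)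
  have : Nonempty (Fin m.2) := ⟨⟨0, hm.2⟩⟩
  have h1 : ∀ᵐ p ∂layer a ω H m, (∀ i, 0 < p.1 i) ∧ ∑ i, p.1 i = 1 :=
    Measure.quasiMeasurePreserving_fst.ae (ae_dirichlet (ha m.1 hm.1))
  have h2 : ∀ᵐ p ∂layer a ω H m, (∀ i, 0 < p.2.1 i) ∧ ∑ i, p.2.1 i = 1 :=
    Measure.quasiMeasurePreserving_snd.ae
      (Measure.quasiMeasurePreserving_fst.ae (ae_dirichlet (hω m.2)))
  have h3 : ∀ᵐ p ∂layer a ω H m, ∀ l, p.2.2 l ∈ Set.Ioo (0 : ℝ) 1 :=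
    Measure.quasiMeasurePreserving_snd.ae (Measure.quasiMeasurePreserving_snd.ae
      (ae_all_iff.2 fun l => Measure.tendsto_eval_ae_ae.eventually hH))
  filter_upwards [h1, h2, h3] with p h1 h2 h3
  exact ⟨hm.1, hm.2, h1.1, ⟨fun i => (h1.1 i).le, h1.2⟩, ⟨fun i => (h2.1 i).le, h2.2⟩, h3⟩

lemma ae_prior (ha : ∀ k, 1 ≤ k → ∀ j, 0 < a k j) (hω : ∀ J j, 0 < ω J j)
    [IsProbabilityMeasure H] (hH : ∀ᵐ θ ∂H, θ ∈ Set.Ioo (0 : ℝ) 1) :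
    ∀ᵐ ξ ∂prior n r c a ω H, ξ.Admissible := by
  rw [prior, Measure.ae_sum_iff]
  intro m
  by_cases hm : 1 ≤ m.1 ∧ 1 ≤ m.2
  · refine Measure.ae_smul_measure ?_ _
    rw [(measurableEmbedding_sigmaMk m).ae_map_iff]
    exact ae_layer ha hω hH hm
  · rw [geomWeight_mul_eq_zero hm, zero_smul]
    simp

lemma prior_univ (hn : 2 ≤ n) (hr : 0 < r) (hc : 0 < c) (ha : ∀ k, 1 ≤ k → ∀ j, 0 < a k j)
    (hω : ∀ J j, 0 < ω J j) [IsProbabilityMeasure H] : prior n r c a ω H Set.univ = 1 := by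
  rw [prior_apply MeasurableSet.univ]
  have : ∀ m : ℕ × ℕ, geomWeight n r m.1 * geomWeight n c m.2 *
      layer a ω H m ((Sigma.mk m : LayerParam m → Param) ⁻¹' Set.univ)
      = geomWeight n r m.1 * geomWeight n c m.2 := fun m => by
    by_cases hm : 1 ≤ m.1 ∧ 1 ≤ m.2
    · have := isProbabilityMeasure_layer (H := H) ha hω hm.1
      rw [Set.preimage_univ, measure_univ, mul_one]
    · rw [geomWeight_mul_eq_zero hm, zero_mul]
  simp only [this]
  rw [tsum_geomWeight_mul, tsum_geomWeight hn hr, tsum_geomWeight hn hc, one_mul]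

/-- The prior probability of the complement of the sieve. -/
lemma prior_compl_sieve_le (hn : 2 ≤ n) (hr : 0 < r) (hc : 0 < c)
    (ha : ∀ k, 1 ≤ k → ∀ j, 0 < a k j) (hω : ∀ J j, 0 < ω J j) [IsProbabilityMeasure H]
    (K : ℕ) (δ : ℝ) :
    prior n r c a ω H (sieve K δ)ᶜ ≤ ENNReal.ofReal (((n : ℝ) ^ (-r)) ^ K)
      + ENNReal.ofReal (((n : ℝ) ^ (-c)) ^ K) + K * H (Set.Iio δ) := by
  rw [prior_apply (measurableSet_sieve K δ).compl]
  have key : ∀ m : ℕ × ℕ, geomWeight n r m.1 * geomWeight n c m.2 *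
      layer a ω H m ((Sigma.mk m : LayerParam m → Param) ⁻¹' (sieve K δ)ᶜ)
      ≤ (if K < m.1 then geomWeight n r m.1 else 0) * geomWeight n c m.2
        + geomWeight n r m.1 * (if K < m.2 then geomWeight n c m.2 else 0)
        + geomWeight n r m.1 * (geomWeight n c m.2 * (K * H (Set.Iio δ))) := fun m => by
    by_cases hm : 1 ≤ m.1 ∧ 1 ≤ m.2
    swap
    · rw [geomWeight_mul_eq_zero hm, zero_mul]
      exact zero_le
    have := isProbabilityMeasure_dirichlet (ha m.1 hm.1)
    have := isProbabilityMeasure_dirichlet (hω m.2)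
    have := isProbabilityMeasure_layer (H := H) ha hω hm.1
    have hle : geomWeight n r m.1 * geomWeight n c m.2 *
        layer a ω H m ((Sigma.mk m : LayerParam m → Param) ⁻¹' (sieve K δ)ᶜ)
        ≤ geomWeight n r m.1 * geomWeight n c m.2 := mul_le_of_le_one_right' prob_le_one
    by_cases h1 : K < m.1
    · rw [if_pos h1, add_assoc]
      exact hle.trans le_self_add
    by_cases h2 : K < m.2
    · rw [if_pos h2, if_neg h1, zero_mul, zero_add]
      exact hle.trans le_self_add
    rw [if_neg h1, if_neg h2, mul_zero, zero_mul, zero_add, zero_add, mul_assoc]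
    gcongr
    have hsub : (Sigma.mk m : LayerParam m → Param) ⁻¹' (sieve K δ)ᶜ
        ⊆ ⋃ l, Set.univ ×ˢ (Set.univ ×ˢ ((fun θ : Fin m.2 → ℝ => θ l) ⁻¹' Set.Iio δ)) := by
      intro p hp
      by_contra hcon
      refine hp ⟨not_lt.1 h1, not_lt.1 h2, fun l => not_lt.1 fun hl => hcon ?_⟩
      exact Set.mem_iUnion.2 ⟨l, trivial, trivial, hl⟩
    calc layer a ω H m _ ≤ layer a ω H m _ := measure_mono hsub
      _ ≤ ∑ l : Fin m.2, layer a ω H m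
          (Set.univ ×ˢ (Set.univ ×ˢ ((fun θ : Fin m.2 → ℝ => θ l) ⁻¹' Set.Iio δ))) :=
        measure_iUnion_fintype_le _ _
      _ = ∑ _l : Fin m.2, H (Set.Iio δ) := Finset.sum_congr rfl fun l _ => by
        rw [layer, Measure.prod_prod, Measure.prod_prod, measure_univ, measure_univ, one_mul,
          one_mul]
        exact (measurePreserving_eval (fun _ : Fin m.2 => H) l).measure_preimage
          measurableSet_Iio.nullMeasurableSet
      _ = m.2 * H (Set.Iio δ) := by simp
      _ ≤ K * H (Set.Iio δ) := by
        gcongr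
        exact not_lt.1 h2
  refine (ENNReal.tsum_le_tsum key).trans ?_
  rw [ENNReal.tsum_add, ENNReal.tsum_add]
  refine le_of_eq ?_
  rw [tsum_geomWeight_mul (f := fun k => if K < k then geomWeight n r k else 0)
      (g := fun J => geomWeight n c J),
    tsum_geomWeight_mul (f := fun k => geomWeight n r k)
      (g := fun J => if K < J then geomWeight n c J else 0),
    tsum_geomWeight_mul (f := fun k => geomWeight n r k)
      (g := fun J => geomWeight n c J * (K * H (Set.Iio δ))),
    ENNReal.tsum_mul_right, tsum_geomWeight hn hr, tsum_geomWeight hn hc,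
    tsum_geomWeight_tail hn hr, tsum_geomWeight_tail hn hc]
  simp only [one_mul, mul_one]

end Prior

/-! ### Likelihood ratios -/

/-- The likelihood ratio of the parameter `ξ` against the density `g₀`. -/
noncomputable def likelihoodRatio (g₀ : ℝ → ℝ) {n : ℕ} (x : Fin n → ℝ) (ξ : Param) : ℝ≥0∞ :=
  ∏ i, ENNReal.ofReal (ξ.density (x i)) / ENNReal.ofReal (g₀ (x i))

lemma likelihood_eq {g₀ : ℝ → ℝ} {n : ℕ} {x : Fin n → ℝ} (hx : ∀ i, 0 < g₀ (x i)) (ξ : Param) :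
    likelihood x ξ = likelihoodRatio g₀ x ξ * ∏ i, ENNReal.ofReal (g₀ (x i)) := by
  rw [likelihood, likelihoodRatio, ← Finset.prod_mul_distrib]
  refine Finset.prod_congr rfl fun i _ => ?_
  rw [ENNReal.div_mul_cancel (ENNReal.ofReal_pos.2 (hx i)).ne' ENNReal.ofReal_ne_top]

lemma measurable_likelihoodRatio_uncurry {g₀ : ℝ → ℝ} (hg₀ : Measurable g₀) {n : ℕ} (m : ℕ × ℕ) :
    Measurable fun q : (Fin n → ℝ) × LayerParam m => likelihoodRatio g₀ q.1 ⟨m, q.2⟩ := by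
  unfold likelihoodRatio Param.density
  refine Finset.measurable_prod _ fun i _ => Measurable.div ?_ ?_
  · have : Measurable fun q : (Fin n → ℝ) × LayerParam m =>
        mixDensity m.1 m.2 q.2.1 q.2.2.1 q.2.2.2 (q.1 i) :=
      measurable_mixDensity_comp (by fun_prop) (by fun_prop) (by fun_prop) (by fun_prop)
    exact ENNReal.measurable_ofReal.comp this
  · fun_prop

lemma measurable_likelihoodRatio_layer {g₀ : ℝ → ℝ} (hg₀ : Measurable g₀) {n : ℕ}
    (x : Fin n → ℝ) (m : ℕ × ℕ) :
    Measurable fun p : LayerParam m => likelihoodRatio g₀ x ⟨m, p⟩ := by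
  have h : Measurable fun p : LayerParam m => (x, p) := measurable_prodMk_left
  have := (measurable_likelihoodRatio_uncurry hg₀ m).comp h
  exact this

lemma measurable_likelihoodRatio {g₀ : ℝ → ℝ} (hg₀ : Measurable g₀) {n : ℕ} (x : Fin n → ℝ) :
    Measurable (likelihoodRatio g₀ x) :=
  measurable_of_sigma fun m => measurable_likelihoodRatio_layer hg₀ x m

lemma lintegral_pi_prod {n : ℕ} {μ : Measure ℝ} [IsProbabilityMeasure μ] {f : ℝ → ℝ≥0∞}
    (hf : Measurable f) :
    ∫⁻ x, ∏ i, f (x i) ∂(Measure.pi fun _ : Fin n => μ) = (∫⁻ y, f y ∂μ) ^ n := by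
  rw [lintegral_prod_eq_prod_lintegral_of_indepFun Finset.univ (fun i (x : Fin n → ℝ) => f (x i))
    (iIndepFun_pi (X := fun _ => f) fun _ => hf.aemeasurable)
    fun i => hf.comp (measurable_pi_apply i)]
  have : ∀ i : Fin n, ∫⁻ x, f (x i) ∂(Measure.pi fun _ : Fin n => μ) = ∫⁻ y, f y ∂μ := fun i =>
    (measurePreserving_eval (fun _ : Fin n => μ) i).lintegral_comp hf
  simp [this]

lemma lintegral_law {g₀ : ℝ → ℝ} (hg₀ : Measurable g₀) {f : ℝ → ℝ≥0∞} (hf : Measurable f) :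
    ∫⁻ y, f y ∂law g₀ = ∫⁻ y in Set.Ioo 0 1, ENNReal.ofReal (g₀ y) * f y := by
  rw [law, lintegral_withDensity_eq_lintegral_mul _ (by fun_prop) hf]
  rfl

lemma lintegral_likelihoodRatio_le {g₀ : ℝ → ℝ} (hg₀ : Measurable g₀)
    [IsProbabilityMeasure (law g₀)] {n : ℕ} {ξ : Param} (hξ : ξ.Admissible) :
    ∫⁻ x, likelihoodRatio g₀ x ξ ∂(Measure.pi fun _ : Fin n => law g₀) ≤ 1 := by
  have hm := measurable_density ξ
  unfold likelihoodRatio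
  rw [lintegral_pi_prod (f := fun y => ENNReal.ofReal (ξ.density y) / ENNReal.ofReal (g₀ y))
    (by fun_prop), lintegral_law hg₀ (by fun_prop)]
  refine pow_le_one₀ zero_le ?_
  rw [← hξ.lintegral_density]
  exact lintegral_mono fun y => ENNReal.mul_div_le

section Fubini

variable {n : ℕ} {r c : ℝ} {a : (k : ℕ) → Fin (k + 1) → ℝ} {ω : (J : ℕ) → Fin J → ℝ}
  {H : Measure ℝ}

lemma measurable_lintegral_layer (ha : ∀ k, 1 ≤ k → ∀ j, 0 < a k j) (hω : ∀ J j, 0 < ω J j)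
    [IsProbabilityMeasure H] {g₀ : ℝ → ℝ} (hg₀ : Measurable g₀) {S : Set Param}
    (hS : MeasurableSet S) (m : ℕ × ℕ) :
    Measurable fun x : Fin n → ℝ => geomWeight n r m.1 * geomWeight n c m.2 *
      ∫⁻ p, S.indicator (likelihoodRatio g₀ x) ⟨m, p⟩ ∂layer a ω H m := by
  by_cases hm : 1 ≤ m.1 ∧ 1 ≤ m.2
  · have := isProbabilityMeasure_layer (H := H) ha hω hm.1
    refine Measurable.const_mul (Measurable.lintegral_prod_right'
      (f := fun q => S.indicator (likelihoodRatio g₀ q.1) ⟨m, q.2⟩) ?_) _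
    exact (measurable_likelihoodRatio_uncurry hg₀ m).indicator
      ((measurable_sigmaMk m).comp measurable_snd hS)
  · simp only [geomWeight_mul_eq_zero hm, zero_mul]
    exact measurable_const

lemma measurable_lintegral_likelihoodRatio (ha : ∀ k, 1 ≤ k → ∀ j, 0 < a k j)
    (hω : ∀ J j, 0 < ω J j) [IsProbabilityMeasure H] {g₀ : ℝ → ℝ} (hg₀ : Measurable g₀)
    {S : Set Param} (hS : MeasurableSet S) :
    Measurable fun x : Fin n → ℝ =>
      ∫⁻ ξ, S.indicator (likelihoodRatio g₀ x) ξ ∂prior n r c a ω H := by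
  have : ∀ x : Fin n → ℝ, Measurable (S.indicator (likelihoodRatio g₀ x)) := fun x =>
    (measurable_likelihoodRatio hg₀ x).indicator hS
  simp only [fun x => lintegral_prior (n := n) (r := r) (c := c) (a := a) (ω := ω) (H := H)
    (this x)]
  exact Measurable.tsum fun m => measurable_lintegral_layer ha hω hg₀ hS m

/-- The likelihood ratios integrate to at most `1` under the truth, so a set of parameters
contributes no more to the expected numerator of the posterior than its prior probability. -/
lemma lintegral_lintegral_likelihoodRatio_le (ha : ∀ k, 1 ≤ k → ∀ j, 0 < a k j)
    (hω : ∀ J j, 0 < ω J j) [IsProbabilityMeasure H] (hH : ∀ᵐ θ ∂H, θ ∈ Set.Ioo (0 : ℝ) 1)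
    {g₀ : ℝ → ℝ} (hg₀ : Measurable g₀) [IsProbabilityMeasure (law g₀)] {S : Set Param}
    (hS : MeasurableSet S) :
    ∫⁻ x, ∫⁻ ξ, S.indicator (likelihoodRatio g₀ x) ξ ∂prior n r c a ω H
      ∂(Measure.pi fun _ : Fin n => law g₀) ≤ prior n r c a ω H S := by
  have hmeas : ∀ x : Fin n → ℝ, Measurable (S.indicator (likelihoodRatio g₀ x)) := fun x =>
    (measurable_likelihoodRatio hg₀ x).indicator hS
  simp only [fun x => lintegral_prior (n := n) (r := r) (c := c) (a := a) (ω := ω) (H := H)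
    (hmeas x)]
  rw [lintegral_tsum fun m => (measurable_lintegral_layer ha hω hg₀ hS m).aemeasurable,
    prior_apply hS]
  refine ENNReal.tsum_le_tsum fun m => ?_
  by_cases hm : 1 ≤ m.1 ∧ 1 ≤ m.2
  swap
  · simp [geomWeight_mul_eq_zero hm]
  have := isProbabilityMeasure_layer (H := H) ha hω hm.1
  have hq : Measurable fun q : (Fin n → ℝ) × LayerParam m =>
      S.indicator (likelihoodRatio g₀ q.1) ⟨m, q.2⟩ :=
    (measurable_likelihoodRatio_uncurry hg₀ m).indicator
      ((measurable_sigmaMk m).comp measurable_snd hS)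
  rw [lintegral_const_mul _ hq.lintegral_prod_right']
  gcongr
  rw [lintegral_lintegral_swap hq.aemeasurable,
    ← lintegral_indicator_one (measurable_sigmaMk m hS)]
  refine lintegral_mono_ae ?_
  filter_upwards [ae_layer ha hω hH hm] with p hp
  by_cases hpS : (⟨m, p⟩ : Param) ∈ S
  · simp only [Set.indicator_of_mem hpS]
    rw [Set.indicator_of_mem (show p ∈ (Sigma.mk m : LayerParam m → Param) ⁻¹' S from hpS)]
    exact lintegral_likelihoodRatio_le hg₀ hp
  · simp only [Set.indicator_of_notMem hpS, lintegral_zero]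
    exact zero_le

end Fubini

/-! ### Almost sure properties of the sample and of the evidence -/

lemma isProbabilityMeasure_law {p : ℝ → ℝ}
    (h1 : ∫⁻ y in Set.Ioo 0 1, ENNReal.ofReal (p y) = 1) : IsProbabilityMeasure (law p) :=
  ⟨by rw [law, withDensity_apply _ MeasurableSet.univ, setLIntegral_univ, h1]⟩

lemma ae_law {p : ℝ → ℝ} (hp : Measurable p) : ∀ᵐ y ∂law p, y ∈ Set.Ioo (0 : ℝ) 1 ∧ 0 < p y := by
  rw [law, ae_withDensity_iff (by fun_prop)]
  filter_upwards [ae_restrict_mem measurableSet_Ioo] with y hy h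
  exact ⟨hy, by simpa using h⟩

lemma ae_pi_law {p : ℝ → ℝ} (hp : Measurable p) [IsProbabilityMeasure (law p)] (n : ℕ) :
    ∀ᵐ x ∂(Measure.pi fun _ : Fin n => law p), ∀ i, x i ∈ Set.Ioo (0 : ℝ) 1 ∧ 0 < p (x i) :=
  ae_all_iff.2 fun i =>
    (Measure.tendsto_eval_ae_ae (μ := fun _ : Fin n => law p) (i := i)).eventually (ae_law hp)

lemma evidence_eq {g₀ : ℝ → ℝ} (hg₀ : Measurable g₀) (Λ : Measure Param) {n : ℕ} {x : Fin n → ℝ}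
    (hx : ∀ i, 0 < g₀ (x i)) :
    evidence Λ x = (∫⁻ ξ, likelihoodRatio g₀ x ξ ∂Λ) * ∏ i, ENNReal.ofReal (g₀ (x i)) := by
  rw [evidence, ← lintegral_mul_const _ (measurable_likelihoodRatio hg₀ x)]
  exact lintegral_congr fun ξ => likelihood_eq hx ξ

lemma ae_evidence_ne {n : ℕ} {r c : ℝ} {a : (k : ℕ) → Fin (k + 1) → ℝ}
    {ω : (J : ℕ) → Fin J → ℝ} {H : Measure ℝ} (hn : 2 ≤ n) (hr : 0 < r) (hc : 0 < c)
    (ha : ∀ k, 1 ≤ k → ∀ j, 0 < a k j) (hω : ∀ J j, 0 < ω J j) [IsProbabilityMeasure H]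
    (hH : ∀ᵐ θ ∂H, θ ∈ Set.Ioo (0 : ℝ) 1) {g₀ : ℝ → ℝ} (hg₀ : Measurable g₀)
    [IsProbabilityMeasure (law g₀)] :
    ∀ᵐ x ∂(Measure.pi fun _ : Fin n => law g₀),
      evidence (prior n r c a ω H) x ≠ 0 ∧ evidence (prior n r c a ω H) x ≠ ⊤ := by
  have hfin : ∀ᵐ x ∂(Measure.pi fun _ : Fin n => law g₀),
      ∫⁻ ξ, Set.univ.indicator (likelihoodRatio g₀ x) ξ ∂prior n r c a ω H < ⊤ := by
    refine ae_lt_top (measurable_lintegral_likelihoodRatio ha hω hg₀ MeasurableSet.univ) ?_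
    refine ne_top_of_le_ne_top ?_
      (lintegral_lintegral_likelihoodRatio_le ha hω hH hg₀ MeasurableSet.univ)
    rw [prior_univ hn hr hc ha hω]
    exact ENNReal.one_ne_top
  filter_upwards [hfin, ae_pi_law hg₀ n] with x hx1 hx2
  have hpos := fun i => (hx2 i).2
  simp only [Set.indicator_univ] at hx1
  constructor
  · rw [evidence_eq hg₀ _ hpos]
    refine mul_ne_zero (fun h0 => ?_)
      (Finset.prod_ne_zero_iff.2 fun i _ => (ENNReal.ofReal_pos.2 (hpos i)).ne')
    rw [lintegral_eq_zero_iff (measurable_likelihoodRatio hg₀ x)] at h0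
    have hfalse : ∀ᵐ _ξ ∂prior n r c a ω H, False := by
      filter_upwards [h0, ae_prior ha hω hH] with ξ h1 h2
      refine absurd h1 (Finset.prod_ne_zero_iff.2 fun i _ => ?_)
      exact ENNReal.div_ne_zero.2
        ⟨(ENNReal.ofReal_pos.2 (h2.density_pos (hx2 i).1)).ne', ENNReal.ofReal_ne_top⟩
    have huniv := prior_univ (H := H) hn hr hc ha hω
    rw [ae_iff] at hfalse
    simp only [not_false_eq_true] at hfalse
    have : prior n r c a ω H Set.univ = 0 := hfalse
    rw [this] at huniv
    exact zero_ne_one huniv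
  · rw [evidence_eq hg₀ _ hpos]
    exact ENNReal.mul_ne_top hx1.ne (ENNReal.prod_ne_top fun i _ => ENNReal.ofReal_ne_top)

/-! ### Hellinger affinity with an upper bracket -/

lemma hellinger_sq (p q : ℝ → ℝ) :
    hellinger p q ^ 2 = ∫⁻ y in Set.Ioo 0 1, ENNReal.ofReal ((√(p y) - √(q y)) ^ 2) := by
  have h := eLpNorm_nnreal_pow_eq_lintegral (f := fun y => √(p y) - √(q y))
    (μ := volume.restrict (Set.Ioo 0 1)) (p := 2) two_ne_zero
  simp only [NNReal.coe_ofNat, ENNReal.rpow_ofNat, ENNReal.coe_ofNat] at h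
  rw [hellinger, h]
  refine lintegral_congr fun y => ?_
  rw [← ofReal_norm, ← ENNReal.ofReal_pow (norm_nonneg _), Real.norm_eq_abs, sq_abs]

lemma hellinger_sq_le {p q : ℝ → ℝ} (hp : Measurable p)
    (hp1 : ∫⁻ y in Set.Ioo 0 1, ENNReal.ofReal (p y) = 1)
    (hq1 : ∫⁻ y in Set.Ioo 0 1, ENNReal.ofReal (q y) = 1)
    (hp0 : ∀ y ∈ Set.Ioo (0 : ℝ) 1, 0 ≤ p y) (hq0 : ∀ y ∈ Set.Ioo (0 : ℝ) 1, 0 ≤ q y) :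
    hellinger p q ^ 2 ≤ 2 := by
  have h2 : (2 : ℝ≥0∞) = ∫⁻ y in Set.Ioo 0 1, (ENNReal.ofReal (p y) + ENNReal.ofReal (q y)) := by
    rw [lintegral_add_left (by fun_prop), hp1, hq1, one_add_one_eq_two]
  rw [hellinger_sq, h2]
  refine setLIntegral_mono' measurableSet_Ioo fun y hy => ?_
  rw [← ENNReal.ofReal_add (hp0 y hy) (hq0 y hy)]
  refine ENNReal.ofReal_le_ofReal ?_
  nlinarith [Real.sq_sqrt (hp0 y hy), Real.sq_sqrt (hq0 y hy),
    mul_nonneg (Real.sqrt_nonneg (p y)) (Real.sqrt_nonneg (q y))]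

/-- If `u ≥ p` is an upper bracket of excess mass `n⁻²` and `p` has Hellinger distance at least `h`
from `q`, then the affinity of `u` and `q` is at most `1 + 1 / n - h ^ 2 / 2`. -/
lemma lintegral_sqrt_mul_le {p q u : ℝ → ℝ} {h : ℝ} {n : ℕ} (hn : 2 ≤ n) (hh : 0 ≤ h)
    (hp : Measurable p) (hq : Measurable q) (hu : Measurable u)
    (hp1 : ∫⁻ y in Set.Ioo 0 1, ENNReal.ofReal (p y) = 1)
    (hq1 : ∫⁻ y in Set.Ioo 0 1, ENNReal.ofReal (q y) = 1)
    (hp0 : ∀ y ∈ Set.Ioo (0 : ℝ) 1, 0 ≤ p y) (hq0 : ∀ y ∈ Set.Ioo (0 : ℝ) 1, 0 ≤ q y)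
    (hpu : ∀ y ∈ Set.Ioo (0 : ℝ) 1, p y ≤ u y)
    (hu1 : ∫⁻ y in Set.Ioo 0 1, ENNReal.ofReal (u y) ≤ ENNReal.ofReal (1 + 1 / (n : ℝ) ^ 2))
    (hd : ENNReal.ofReal h ≤ hellinger p q) :
    ∫⁻ y in Set.Ioo 0 1, ENNReal.ofReal √(u y * q y) ≤ ENNReal.ofReal (1 + 1 / n - h ^ 2 / 2) := by
  have hn0 : (0 : ℝ) < n := by exact_mod_cast (by omega : 0 < n)
  have hd2 : ENNReal.ofReal (h ^ 2) ≤
      ∫⁻ y in Set.Ioo 0 1, ENNReal.ofReal ((√(p y) - √(q y)) ^ 2) := by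
    rw [← hellinger_sq, ENNReal.ofReal_pow hh]
    gcongr
  -- the arithmetic-geometric mean inequality bounds the affinity of `u - p` and `q`
  have hpt : ∀ y ∈ Set.Ioo (0 : ℝ) 1,
      2 * √(u y * q y) + (√(p y) - √(q y)) ^ 2 + n * p y
        ≤ p y + q y + n * u y + 1 / n * q y := fun y hy => by
    have h1 := hp0 y hy
    have h2 := hq0 y hy
    have h3 := hpu y hy
    have h4 : √(u y * q y) ≤ √(p y) * √(q y) + √(u y - p y) * √(q y) := by
      rw [Real.sqrt_mul' _ h2, ← add_mul]
      refine mul_le_mul_of_nonneg_right ?_ (Real.sqrt_nonneg _)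
      refine Real.sqrt_le_iff.2 ⟨by positivity, ?_⟩
      nlinarith [Real.sq_sqrt h1, Real.sq_sqrt (sub_nonneg.2 h3),
        mul_nonneg (Real.sqrt_nonneg (p y)) (Real.sqrt_nonneg (u y - p y))]
    have h5 : 2 * (√(u y - p y) * √(q y)) ≤ n * (u y - p y) + 1 / n * q y := by
      have e1 := Real.sq_sqrt (sub_nonneg.2 h3)
      have e2 := Real.sq_sqrt h2
      have e3 : 0 ≤ (n * √(u y - p y) - √(q y)) ^ 2 / n := by positivity
      have e4 : (n * √(u y - p y) - √(q y)) ^ 2 / n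
          = n * √(u y - p y) ^ 2 + 1 / n * √(q y) ^ 2 - 2 * (√(u y - p y) * √(q y)) := by
        field_simp
        ring
      rw [e1, e2] at e4
      linarith
    have h6 := Real.sq_sqrt h1
    have h7 := Real.sq_sqrt h2
    nlinarith
  set A := ∫⁻ y in Set.Ioo 0 1, ENNReal.ofReal √(u y * q y) with hA
  have hint : 2 * A + ENNReal.ofReal (h ^ 2) + n
      ≤ ENNReal.ofReal (2 + 2 / n) + n := by
    calc 2 * A + ENNReal.ofReal (h ^ 2) + n
        ≤ 2 * A + (∫⁻ y in Set.Ioo 0 1, ENNReal.ofReal ((√(p y) - √(q y)) ^ 2))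
          + n * ∫⁻ y in Set.Ioo 0 1, ENNReal.ofReal (p y) := by
          rw [hp1, mul_one]; gcongr
      _ = ∫⁻ y in Set.Ioo 0 1, (2 * ENNReal.ofReal √(u y * q y)
          + ENNReal.ofReal ((√(p y) - √(q y)) ^ 2) + n * ENNReal.ofReal (p y)) := by
          rw [lintegral_add_left (by fun_prop), lintegral_add_left (by fun_prop),
            lintegral_const_mul _ (by fun_prop), lintegral_const_mul _ (by fun_prop)]
      _ ≤ ∫⁻ y in Set.Ioo 0 1, (ENNReal.ofReal (p y) + ENNReal.ofReal (q y)
          + n * ENNReal.ofReal (u y) + ENNReal.ofReal (1 / n) * ENNReal.ofReal (q y)) := by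
          refine setLIntegral_mono' measurableSet_Ioo fun y hy => ?_
          have h1 := hp0 y hy
          have h2 := hq0 y hy
          have h3 : 0 ≤ u y := h1.trans (hpu y hy)
          rw [← ENNReal.ofReal_natCast n, ← ENNReal.ofReal_ofNat 2,
            ← ENNReal.ofReal_mul (by norm_num), ← ENNReal.ofReal_mul hn0.le,
            ← ENNReal.ofReal_mul hn0.le, ← ENNReal.ofReal_mul (by positivity),
            ← ENNReal.ofReal_add (by positivity) (by positivity),
            ← ENNReal.ofReal_add (by positivity) (by positivity),
            ← ENNReal.ofReal_add (by positivity) (by positivity),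
            ← ENNReal.ofReal_add (by positivity) (by positivity),
            ← ENNReal.ofReal_add (by positivity) (by positivity)]
          exact ENNReal.ofReal_le_ofReal (hpt y hy)
      _ = 1 + 1 + n * (∫⁻ y in Set.Ioo 0 1, ENNReal.ofReal (u y)) + ENNReal.ofReal (1 / n) := by
          rw [lintegral_add_left (by fun_prop), lintegral_add_left (by fun_prop),
            lintegral_add_left (by fun_prop), lintegral_const_mul _ (by fun_prop),
            lintegral_const_mul _ (by fun_prop), hp1, hq1, mul_one]
      _ ≤ 1 + 1 + n * ENNReal.ofReal (1 + 1 / (n : ℝ) ^ 2) + ENNReal.ofReal (1 / n) := by gcongr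
      _ = ENNReal.ofReal (2 + 2 / n) + n := by
          rw [← ENNReal.ofReal_natCast n, ← ENNReal.ofReal_one,
            ← ENNReal.ofReal_mul hn0.le, ← ENNReal.ofReal_add (by positivity) (by positivity),
            ← ENNReal.ofReal_add (by positivity) (by positivity),
            ← ENNReal.ofReal_add (by positivity) (by positivity),
            ← ENNReal.ofReal_add (by positivity) (by positivity)]
          congr 1
          field_simp
          ring
  have hint2 : 2 * A + ENNReal.ofReal (h ^ 2) ≤ ENNReal.ofReal (2 + 2 / n) :=
    (ENNReal.add_le_add_iff_right (ENNReal.natCast_ne_top n)).1 hint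
  have hAt : A ≠ ⊤ := by
    rintro h0
    rw [h0] at hint2
    simp at hint2
  rw [← ENNReal.ofReal_toReal hAt, ← ENNReal.ofReal_ofNat 2,
    ← ENNReal.ofReal_mul (by norm_num), ← ENNReal.ofReal_add (by positivity) (by positivity),
    ENNReal.ofReal_le_ofReal_iff (by positivity)] at hint2
  rw [← ENNReal.ofReal_toReal hAt]
  refine ENNReal.ofReal_le_ofReal ?_
  have : (2 : ℝ) / n = 2 * (1 / n) := by ring
  linarith

/-! ### The expected posterior probability at a fixed sample size -/

lemma posterior_le_one (Λ : Measure Param) {n : ℕ} (x : Fin n → ℝ) (A : Set Param) :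
    posterior Λ x A ≤ 1 :=
  (ENNReal.div_le_div_right (setLIntegral_le_lintegral _ _) _).trans ENNReal.div_self_le_one

lemma lintegral_law_sqrt_div_le {g₀ u : ℝ → ℝ} (hg₀ : Measurable g₀) (hu : Measurable u)
    (hg₀0 : ∀ y ∈ Set.Ioo (0 : ℝ) 1, 0 ≤ g₀ y) :
    ∫⁻ y, ENNReal.ofReal √(u y / g₀ y) ∂law g₀
      ≤ ∫⁻ y in Set.Ioo 0 1, ENNReal.ofReal √(u y * g₀ y) := by
  rw [lintegral_law hg₀ (by fun_prop)]
  refine setLIntegral_mono' measurableSet_Ioo fun y hy => ?_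
  have h0 := hg₀0 y hy
  rw [← ENNReal.ofReal_mul h0]
  refine ENNReal.ofReal_le_ofReal ?_
  rcases h0.eq_or_lt with h1 | h1
  · rw [← h1]; simp
  · nth_rewrite 1 [← Real.sqrt_sq h0]
    rw [← Real.sqrt_mul (by positivity)]
    refine le_of_eq (congrArg _ ?_)
    field_simp

lemma ofReal_le_sq_sqrt_div_mul {u g : ℝ} (hg : 0 < g) :
    ENNReal.ofReal u ≤ ENNReal.ofReal √(u / g) ^ 2 * ENNReal.ofReal g := by
  rcases le_or_gt u 0 with h | h
  · rw [ENNReal.ofReal_of_nonpos h]; exact zero_le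
  · rw [← ENNReal.ofReal_pow (Real.sqrt_nonneg _), Real.sq_sqrt (by positivity),
      ← ENNReal.ofReal_mul (by positivity), div_mul_cancel₀ _ hg.ne']

/-- The expected posterior probability of `A` in terms of four quantities: the probability of a bad
event `B`, a bound `d ^ 2` for the inverse of the normalized evidence off `B`, the prior probability
of the complement of a sieve `S`, and a finite set of upper brackets of `A ∩ S` that have affinity
at most `ρ` with the truth. The set `A` need not be measurable. -/
lemma lintegral_posterior_le {n : ℕ} {r c : ℝ} {a : (k : ℕ) → Fin (k + 1) → ℝ}
    {ω : (J : ℕ) → Fin J → ℝ} {H : Measure ℝ} (hn : 2 ≤ n) (hr : 0 < r) (hc : 0 < c)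
    (ha : ∀ k, 1 ≤ k → ∀ j, 0 < a k j) (hω : ∀ J j, 0 < ω J j) [IsProbabilityMeasure H]
    (hH : ∀ᵐ θ ∂H, θ ∈ Set.Ioo (0 : ℝ) 1) {g₀ : ℝ → ℝ} (hg₀ : Measurable g₀)
    (hg₀0 : ∀ y ∈ Set.Ioo (0 : ℝ) 1, 0 ≤ g₀ y)
    [IsProbabilityMeasure (law g₀)] {A S : Set Param} (hS : MeasurableSet S)
    {B : Set (Fin n → ℝ)} (hB : MeasurableSet B) {d ρ : ℝ≥0∞}
    (hd : ∀ x ∉ B, (∀ i, x i ∈ Set.Ioo (0 : ℝ) 1 ∧ 0 < g₀ (x i)) →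
      1 ≤ d ^ 2 * ∫⁻ ξ, likelihoodRatio g₀ x ξ ∂prior n r c a ω H)
    {𝒰 : Finset (ℝ → ℝ)} (h𝒰 : ∀ u ∈ 𝒰, Measurable u)
    (hA : ∀ ξ ∈ A, ξ ∈ S → ξ.Admissible → ∃ u ∈ 𝒰, ∀ y ∈ Set.Ioo (0 : ℝ) 1, ξ.density y ≤ u y)
    (hρ : ∀ u ∈ 𝒰, ∫⁻ y in Set.Ioo 0 1, ENNReal.ofReal √(u y * g₀ y) ≤ ρ) :
    ∫⁻ x, posterior (prior n r c a ω H) x A ∂(Measure.pi fun _ : Fin n => law g₀)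
      ≤ (Measure.pi fun _ : Fin n => law g₀) B + d ^ 2 * prior n r c a ω H Sᶜ
        + d * (𝒰.card * ρ ^ n) := by
  set P := Measure.pi fun _ : Fin n => law g₀ with hP
  set Λ := prior n r c a ω H with hΛ
  set V : (Fin n → ℝ) → ℝ≥0∞ := fun x => ∑ u ∈ 𝒰, ∏ i, ENNReal.ofReal √(u (x i) / g₀ (x i))
    with hV
  set N : (Fin n → ℝ) → ℝ≥0∞ := fun x => ∫⁻ ξ, Sᶜ.indicator (likelihoodRatio g₀ x) ξ ∂Λ with hN
  have hNm : Measurable N := measurable_lintegral_likelihoodRatio ha hω hg₀ hS.compl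
  have hvm : ∀ u ∈ 𝒰, Measurable fun y => ENNReal.ofReal √(u y / g₀ y) := fun u hu => by
    have := h𝒰 u hu
    fun_prop
  have hVterm : ∀ u ∈ 𝒰, Measurable fun x : Fin n → ℝ =>
      ∏ i, ENNReal.ofReal √(u (x i) / g₀ (x i)) := fun u hu =>
    Finset.measurable_prod _ fun i _ => (hvm u hu).comp (measurable_pi_apply i)
  have hVm : Measurable V := Finset.measurable_fun_sum _ hVterm
  have hpt : ∀ᵐ x ∂P, posterior Λ x A ≤ B.indicator 1 x + d ^ 2 * N x + d * V x := by
    filter_upwards [ae_pi_law hg₀ n] with x hx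
    by_cases hxB : x ∈ B
    · rw [Set.indicator_of_mem hxB, Pi.one_apply, add_assoc]
      exact (posterior_le_one _ _ _).trans le_self_add
    rw [Set.indicator_of_notMem hxB, zero_add]
    have hpos := fun i => (hx i).2
    set G := ∏ i, ENNReal.ofReal (g₀ (x i)) with hG
    have hnum : ∫⁻ ξ in A, likelihood x ξ ∂Λ ≤ (N x + V x ^ 2) * G := by
      have hm1 : Measurable (Sᶜ.indicator (likelihoodRatio g₀ x)) :=
        (measurable_likelihoodRatio hg₀ x).indicator hS.compl
      calc ∫⁻ ξ in A, likelihood x ξ ∂Λ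
          ≤ ∫⁻ ξ in A, (Sᶜ.indicator (likelihoodRatio g₀ x) ξ + V x ^ 2) * G ∂Λ := by
            refine setLIntegral_mono_ae ((hm1.add_const _).mul_const _).aemeasurable ?_
            filter_upwards [ae_prior ha hω hH] with ξ hξ hξA
            rw [likelihood_eq hpos]
            by_cases hξS : ξ ∈ S
            · rw [Set.indicator_of_notMem (by simpa using hξS), zero_add,
                ← likelihood_eq hpos]
              obtain ⟨u, hu, hle⟩ := hA ξ hξA hξS hξ
              calc likelihood x ξ
                  ≤ ∏ i, (ENNReal.ofReal √(u (x i) / g₀ (x i)) ^ 2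
                    * ENNReal.ofReal (g₀ (x i))) :=
                    Finset.prod_le_prod' fun i _ =>
                      (ENNReal.ofReal_le_ofReal (hle _ (hx i).1)).trans
                        (ofReal_le_sq_sqrt_div_mul (hpos i))
                _ = (∏ i, ENNReal.ofReal √(u (x i) / g₀ (x i))) ^ 2 * G := by
                    rw [Finset.prod_mul_distrib, Finset.prod_pow]
                _ ≤ V x ^ 2 * G := by
                    gcongr
                    exact Finset.single_le_sum
                      (f := fun u : ℝ → ℝ => ∏ i, ENNReal.ofReal √(u (x i) / g₀ (x i)))
                      (fun _ _ => zero_le) hu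
            · rw [Set.indicator_of_mem (by simpa using hξS)]
              gcongr
              exact le_self_add
        _ ≤ ∫⁻ ξ, (Sᶜ.indicator (likelihoodRatio g₀ x) ξ + V x ^ 2) * G ∂Λ :=
            setLIntegral_le_lintegral _ _
        _ = (N x + V x ^ 2) * G := by
            rw [lintegral_mul_const _ (hm1.add_const _), lintegral_add_left hm1, lintegral_const,
              prior_univ hn hr hc ha hω, mul_one]
    have hpost : posterior Λ x A ≤ d ^ 2 * N x + (d * V x) ^ 2 := by
      refine ENNReal.div_le_of_le_mul ?_
      rw [evidence_eq hg₀ _ hpos]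
      calc ∫⁻ ξ in A, likelihood x ξ ∂Λ ≤ (N x + V x ^ 2) * G * 1 := by rw [mul_one]; exact hnum
        _ ≤ (N x + V x ^ 2) * G * (d ^ 2 * ∫⁻ ξ, likelihoodRatio g₀ x ξ ∂Λ) := by
            gcongr
            exact hd x hxB hx
        _ = _ := by ring
    -- `min 1 (y ^ 2) ≤ y` is used because `V` has a small expectation, whereas `V ^ 2` has not
    rcases le_total (d * V x) 1 with h1 | h1
    · refine hpost.trans ?_
      gcongr
      exact pow_le_of_le_one zero_le h1 two_ne_zero
    · exact (posterior_le_one _ _ _).trans (h1.trans le_add_self)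
  have hVint : ∫⁻ x, V x ∂P ≤ 𝒰.card * ρ ^ n := by
    rw [lintegral_finsetSum _ hVterm, ← nsmul_eq_mul]
    refine Finset.sum_le_card_nsmul _ _ _ fun u hu => ?_
    rw [lintegral_pi_prod (hvm u hu)]
    gcongr
    exact (lintegral_law_sqrt_div_le hg₀ (h𝒰 u hu) hg₀0).trans (hρ u hu)
  calc ∫⁻ x, posterior Λ x A ∂P
      ≤ ∫⁻ x, (B.indicator 1 x + d ^ 2 * N x + d * V x) ∂P := lintegral_mono_ae hpt
    _ = P B + d ^ 2 * ∫⁻ x, N x ∂P + d * ∫⁻ x, V x ∂P := by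
        rw [lintegral_add_left, lintegral_add_left, lintegral_indicator_one hB,
          lintegral_const_mul _ hNm, lintegral_const_mul _ hVm]
        · exact (measurable_one.indicator hB)
        · exact (measurable_one.indicator hB).add (hNm.const_mul _)
    _ ≤ _ := by
        gcongr
        exact lintegral_lintegral_likelihoodRatio_le ha hω hH hg₀ hS.compl

/-! ### Upper brackets of the sieve -/

lemma mixDensity_le_ratio_mul {k J : ℕ} {β β' : Fin (k + 1) → ℝ} {w w' θ θ' : Fin J → ℝ}
    {x R : ℝ} (hx : 0 < x) (hR : 1 ≤ R) (hβ : ∀ j, 0 ≤ β j) (hββ' : ∀ j, β j ≤ β' j)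
    (hw : ∀ l, 0 ≤ w l) (hww' : ∀ l, w l ≤ w' l) (hθ : ∀ l, 0 < θ l) (hθθ' : ∀ l, θ l ≤ θ' l)
    (hθR : ∀ l, θ' l ≤ R * θ l) :
    mixDensity k J β w θ x ≤ R * mixDensity k J β' w' θ' x := by
  have hβ' := fun j => (hβ j).trans (hββ' j)
  have hw' := fun l => (hw l).trans (hww' l)
  have h1 : ∀ l, kernel k x (θ l) ≤ R * kernel k x (θ' l) := fun l => by
    refine (kernel_le_mul_kernel hx (hθ l) (hθθ' l)).trans ?_
    refine mul_le_mul_of_nonneg_right ?_ (kernel_nonneg hx)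
    rw [div_le_iff₀ (hθ l)]
    exact hθR l
  have h2 : ∀ j : ℕ, kernel (j + 1) x 1 ≤ R * kernel (j + 1) x 1 := fun j =>
    le_mul_of_one_le_left (kernel_nonneg hx) hR
  calc mixDensity k J β w θ x
      ≤ ∑ j : Fin k, β' j.castSucc * (R * kernel (j + 1) x 1)
        + β' (Fin.last k) * ∑ l, w' l * (R * kernel k x (θ' l)) :=
        add_le_add
          (Finset.sum_le_sum fun j _ => mul_le_mul (hββ' _) (h2 j) (kernel_nonneg hx) (hβ' _))
          (mul_le_mul (hββ' _) (Finset.sum_le_sum fun l _ =>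
            mul_le_mul (hww' _) (h1 l) (kernel_nonneg hx) (hw' _))
            (Finset.sum_nonneg fun l _ => mul_nonneg (hw l) (kernel_nonneg hx)) (hβ' _))
    _ = R * mixDensity k J β' w' θ' x := by
        simp only [mixDensity, mul_left_comm _ R, ← Finset.mul_sum]
        ring

/-- Rounding up to a multiple of `1 / N`, as an index in `Fin (N + 1)`. -/
lemma exists_ceil_index {N : ℕ} (hN : 0 < N) {t : ℝ} (ht0 : 0 ≤ t) (ht1 : t ≤ 1) :
    ∃ i : Fin (N + 1), t ≤ (i : ℕ) / (N : ℝ) ∧ ((i : ℕ) : ℝ) / N ≤ t + 1 / N := by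
  have hN' : (0 : ℝ) < N := by exact_mod_cast hN
  have h1 : ⌈t * N⌉₊ ≤ N := Nat.ceil_le.2 (by nlinarith)
  refine ⟨⟨⌈t * N⌉₊, by omega⟩, ?_, ?_⟩
  · rw [le_div_iff₀ hN']
    exact Nat.le_ceil _
  · rw [div_le_iff₀ hN', add_mul, one_div, inv_mul_cancel₀ hN'.ne']
    exact (Nat.ceil_lt_add_one (by positivity)).le

/-- The indices of the upper brackets: grid points with denominator `N` for `(β, w, θ)`, in every
dimension allowed by the sieve. -/
abbrev BracketIndex (K N : ℕ) : Type :=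
  Σ m : Fin (K + 1) × Fin (K + 1), (Fin (m.1 + 1) → Fin (N + 1)) × (Fin m.2 → Fin (N + 1)) ×
    (Fin m.2 → Fin (N + 1))

lemma card_bracketIndex_le (K N : ℕ) :
    Fintype.card (BracketIndex K N) ≤ (K + 1) ^ 2 * (N + 1) ^ (3 * K + 1) := by
  rw [Fintype.card_sigma]
  have : ∀ m ∈ (Finset.univ : Finset (Fin (K + 1) × Fin (K + 1))),
      Fintype.card ((Fin (m.1 + 1) → Fin (N + 1)) × (Fin m.2 → Fin (N + 1)) ×
        (Fin m.2 → Fin (N + 1))) ≤ (N + 1) ^ (3 * K + 1) := fun m _ => by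
    simp only [Fintype.card_prod, Fintype.card_fun, Fintype.card_fin]
    rw [← pow_add, ← pow_add]
    exact Nat.pow_le_pow_right (by omega) (by omega)
  refine (Finset.sum_le_card_nsmul _ _ _ this).trans (le_of_eq ?_)
  simp only [Finset.card_univ, Fintype.card_prod, Fintype.card_fin, smul_eq_mul]
  ring

/-- The sieve with `K < n ^ 2` and support points at least `n⁻²` is covered by the lower sets of
`(K + 1) ^ 2 (n ^ 6 + 1) ^ (3 K + 1)` functions of mass at most `1 + n⁻²`, obtained by rounding all
parameters up to multiples of `n⁻⁶`. -/
lemma exists_upper_brackets {n K : ℕ} (hn : 3 ≤ n) (hK : K + 1 ≤ n ^ 2) :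
    ∃ 𝒰 : Finset (ℝ → ℝ), 𝒰.card ≤ (K + 1) ^ 2 * (n ^ 6 + 1) ^ (3 * K + 1) ∧
      (∀ u ∈ 𝒰, Measurable u) ∧
      ∀ ξ : Param, ξ.Admissible → ξ ∈ sieve K ((n : ℝ) ^ 2)⁻¹ →
        ∃ u ∈ 𝒰, (∀ y ∈ Set.Ioo (0 : ℝ) 1, ξ.density y ≤ u y) ∧
          ∫⁻ y in Set.Ioo 0 1, ENNReal.ofReal (u y) ≤ ENNReal.ofReal (1 + 1 / (n : ℝ) ^ 2) := by
  classical
  set N := n ^ 6 with hN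
  have hn0 : (3 : ℝ) ≤ n := by exact_mod_cast hn
  set z : ℝ := 1 / (n : ℝ) ^ 4 with hz
  have hz0 : 0 < z := by positivity
  have hNpos : 0 < N := by positivity
  let U : BracketIndex K N → ℝ → ℝ := fun t y =>
    (1 + z) * mixDensity t.1.1 t.1.2 (fun j => ((t.2.1 j : ℕ) : ℝ) / N)
      (fun l => ((t.2.2.1 l : ℕ) : ℝ) / N) (fun l => ((t.2.2.2 l : ℕ) : ℝ) / N) y
  refine ⟨Finset.univ.image U, ?_, ?_, ?_⟩
  · exact Finset.card_image_le.trans (card_bracketIndex_le K N)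
  · intro u hu
    obtain ⟨t, -, rfl⟩ := Finset.mem_image.1 hu
    exact (measurable_mixDensity _ _ _ _ _).const_mul _
  rintro ⟨⟨k, J⟩, β, w, θ⟩ ⟨hk, hJ, -, hβ, hw, hθ⟩ ⟨hkK, hJK, hθδ⟩
  simp only at hk hJ hβ hw hθ hkK hJK hθδ
  have hβ1 : ∀ j, β j ≤ 1 := fun j => by
    rw [← hβ.2]; exact Finset.single_le_sum (fun i _ => hβ.1 i) (Finset.mem_univ j)
  have hw1 : ∀ l, w l ≤ 1 := fun l => by
    rw [← hw.2]; exact Finset.single_le_sum (fun i _ => hw.1 i) (Finset.mem_univ l)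
  choose iβ hβ2 hβ3 using fun j => exists_ceil_index hNpos (hβ.1 j) (hβ1 j)
  choose iw hw2 hw3 using fun l => exists_ceil_index hNpos (hw.1 l) (hw1 l)
  choose iθ hθ2 hθ3 using fun l => exists_ceil_index hNpos (hθ l).1.le (hθ l).2.le
  let t : BracketIndex K N := ⟨(⟨k, Nat.lt_succ_of_le hkK⟩, ⟨J, Nat.lt_succ_of_le hJK⟩),
    iβ, iw, iθ⟩
  refine ⟨U t, Finset.mem_image_of_mem _ (Finset.mem_univ _), fun y hy => ?_, ?_⟩
  · refine mixDensity_le_ratio_mul hy.1 (by linarith) hβ.1 hβ2 hw.1 hw2 (fun l => (hθ l).1) hθ2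
      fun l => (hθ3 l).trans ?_
    have h1 : (1 : ℝ) / N = z * ((n : ℝ) ^ 2)⁻¹ := by
      rw [hz, hN]; push_cast; field_simp
    rw [h1, add_mul, one_mul]
    have := hθδ l
    gcongr
  · have hsum : ∀ {m : ℕ} {v : Fin m → ℝ} {i : Fin m → Fin (N + 1)}, m ≤ n ^ 2 →
        ∑ j, v j = 1 → (∀ j, ((i j : ℕ) : ℝ) / N ≤ v j + 1 / N) →
        ∑ j, ((i j : ℕ) : ℝ) / N ≤ 1 + z := fun {m v i} hm hv hi => by
      calc ∑ j, ((i j : ℕ) : ℝ) / N ≤ ∑ j, (v j + 1 / N) := Finset.sum_le_sum fun j _ => hi j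
        _ = 1 + m * (1 / N) := by
          rw [Finset.sum_add_distrib, hv, Finset.sum_const, Finset.card_univ, Fintype.card_fin,
            nsmul_eq_mul]
        _ ≤ 1 + (n : ℝ) ^ 2 * (1 / N) := by
          have : (m : ℝ) ≤ (n : ℝ) ^ 2 := by exact_mod_cast hm
          gcongr
        _ = 1 + z := by rw [hz, hN]; push_cast; field_simp
    have hb := hsum (by omega) hβ.2 hβ3
    have hw4 := hsum (by omega) hw.2 hw3
    have hnn : ∀ i : Fin (N + 1), (0 : ℝ) ≤ ((i : ℕ) : ℝ) / N := fun i => by positivity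
    have hone : ∀ i : Fin (N + 1), ((i : ℕ) : ℝ) / N ≤ 1 := fun i => by
      rw [div_le_one (by exact_mod_cast hNpos)]
      exact_mod_cast Nat.lt_succ_iff.1 i.2
    have hUt : ∫⁻ y in Set.Ioo 0 1, ENNReal.ofReal (U t y)
        = ENNReal.ofReal (1 + z) * ENNReal.ofReal (∑ j : Fin k, ((iβ j.castSucc : ℕ) : ℝ) / N
          + ((iβ (Fin.last k) : ℕ) : ℝ) / N * ∑ l, ((iw l : ℕ) : ℝ) / N) := by
      rw [← lintegral_mixDensity hk (β := fun j => ((iβ j : ℕ) : ℝ) / N)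
        (w := fun l => ((iw l : ℕ) : ℝ) / N) (θ := fun l => ((iθ l : ℕ) : ℝ) / N)
        (fun j => hnn _) (fun l => hnn _)
        (fun l => ⟨(hθ l).1.trans_le (hθ2 l), hone _⟩),
        ← lintegral_const_mul _ (by have := measurable_mixDensity k J; fun_prop)]
      refine lintegral_congr fun y => ?_
      rw [← ENNReal.ofReal_mul (by positivity)]
    rw [hUt, ← ENNReal.ofReal_mul (by positivity)]
    refine ENNReal.ofReal_le_ofReal ?_
    rw [Fin.sum_univ_castSucc] at hb
    have hs0 : 0 ≤ ∑ j : Fin k, ((iβ j.castSucc : ℕ) : ℝ) / N :=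
      Finset.sum_nonneg fun j _ => hnn _
    have hl0 := hnn (iβ (Fin.last k))
    have h1 : ∑ j : Fin k, ((iβ j.castSucc : ℕ) : ℝ) / N
        + ((iβ (Fin.last k) : ℕ) : ℝ) / N * ∑ l, ((iw l : ℕ) : ℝ) / N ≤ (1 + z) * (1 + z) := by
      calc _ ≤ (∑ j : Fin k, ((iβ j.castSucc : ℕ) : ℝ) / N) * (1 + z)
            + ((iβ (Fin.last k) : ℕ) : ℝ) / N * (1 + z) := by
            gcongr
            exact le_mul_of_one_le_right hs0 (by linarith)
        _ = (∑ j : Fin k, ((iβ j.castSucc : ℕ) : ℝ) / N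
            + ((iβ (Fin.last k) : ℕ) : ℝ) / N) * (1 + z) := by ring
        _ ≤ _ := by gcongr
    have hz1 : z ≤ 1 := by
      rw [hz, div_le_one (by positivity)]
      exact one_le_pow₀ (by linarith)
    have h7 : 7 * z ≤ 1 / (n : ℝ) ^ 2 := by
      rw [hz, mul_one_div, div_le_div_iff₀ (by positivity) (by positivity)]
      have : (9 : ℝ) ≤ (n : ℝ) ^ 2 := by nlinarith
      nlinarith
    calc (1 + z) * _ ≤ (1 + z) * ((1 + z) * (1 + z)) := by gcongr
      _ ≤ 1 + 7 * z := by nlinarith [mul_nonneg hz0.le hz0.le]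
      _ ≤ _ := by linarith

/-! ### The evidence from below -/

lemma rpow_window_ge {C t : ℝ} (hC : 0 < C) :
    ∃ D : ℕ, ∀ n : ℕ, 2 ≤ n → ((n : ℝ) ^ D)⁻¹ ≤ C * (((n : ℝ) ^ 6)⁻¹) ^ t := by
  obtain ⟨D, hD⟩ := exists_inv_pow_le hC
  refine ⟨D + 6 * ⌈t⌉₊, fun n hn => ?_⟩
  have hn' : (2 : ℝ) ≤ n := by exact_mod_cast hn
  have h1 : (((n : ℝ) ^ 6)⁻¹) ^ ⌈t⌉₊ ≤ (((n : ℝ) ^ 6)⁻¹) ^ t := by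
    rw [← Real.rpow_natCast]
    exact Real.rpow_le_rpow_of_exponent_ge (by positivity)
      (inv_le_one_of_one_le₀ (one_le_pow₀ (by linarith))) (Nat.le_ceil t)
  rw [pow_add, pow_mul, mul_inv, ← inv_pow ((n : ℝ) ^ 6)]
  have := hD n hn
  gcongr

lemma exp_le_one_sub_inv_pow {n : ℕ} (hn : 2 ≤ n) :
    Real.exp (-6) ≤ ((1 - 1 / (n : ℝ)) ^ 3) ^ n := by
  have hn' : (2 : ℝ) ≤ n := by exact_mod_cast hn
  have h1 : Real.exp (-(2 / n)) ≤ 1 - 1 / n := by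
    have h2 : (0 : ℝ) < 1 - 1 / n := by
      rw [sub_pos, div_lt_one (by linarith)]; linarith
    have h3 := Real.one_sub_inv_le_log_of_pos h2
    rw [← Real.exp_log h2]
    refine Real.exp_le_exp.2 (le_trans ?_ h3)
    have h4 : (1 - 1 / (n : ℝ))⁻¹ = 1 + 1 / (n - 1) := by
      have : (n : ℝ) - 1 ≠ 0 := by linarith
      field_simp
      ring
    have h5 : 1 / ((n : ℝ) - 1) ≤ 2 / n := by
      rw [div_le_div_iff₀ (by linarith) (by linarith)]
      linarith
    rw [h4]
    linarith
  calc Real.exp (-6) = (Real.exp (-(2 / n)) ^ 3) ^ n := by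
        rw [← Real.exp_nat_mul, ← Real.exp_nat_mul]
        congr 1
        push_cast
        field_simp
        norm_num
    _ ≤ _ := by gcongr

/-- If `β` and `w` exceed `1 - 1 / n` times their true values and the support points lie slightly to
the left of the true ones, then the density exceeds `(1 - 1 / n) ^ 3` times the true density outside
of short windows to the left of the true support points. -/
lemma mul_mixDensity_le {n k J : ℕ} (hn : 2 ≤ n) (hk : k ≤ n) {β β₀ : Fin (k + 1) → ℝ}
    {w w₀ θ θ₀ : Fin J → ℝ} {x : ℝ} (hx : 0 < x) (hβ₀ : ∀ j, 0 ≤ β₀ j) (hw₀ : ∀ l, 0 ≤ w₀ l)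
    (hβ : ∀ j, (1 - 1 / (n : ℝ)) * β₀ j ≤ β j) (hw : ∀ l, (1 - 1 / (n : ℝ)) * w₀ l ≤ w l)
    (hθ : ∀ l, θ l ∈ Set.Ioo (θ₀ l - ((n : ℝ) ^ 6)⁻¹) (θ₀ l)) (hθ0 : ∀ l, 0 < θ l)
    (hxw : ∀ l, x ∉ Set.Ioo (θ₀ l - ((n : ℝ) ^ 4)⁻¹) (θ₀ l)) :
    (1 - 1 / (n : ℝ)) ^ 3 * mixDensity k J β₀ w₀ θ₀ x ≤ mixDensity k J β w θ x := by
  have hn' : (2 : ℝ) ≤ n := by exact_mod_cast hn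
  have hk' : (k : ℝ) ≤ n := by exact_mod_cast hk
  set q : ℝ := 1 - 1 / n with hq
  have hi0 : (0 : ℝ) < 1 / n := by positivity
  have hq1 : q ≤ 1 := by linarith
  have hq0 : 0 ≤ q := by
    rw [hq, sub_nonneg, div_le_one (by linarith)]; linarith
  have hker : ∀ l, q * kernel k x (θ₀ l) ≤ kernel k x (θ l) := fun l => by
    refine le_trans ?_ (mul_kernel_le_kernel hx (s := ((n : ℝ) ^ 4)⁻¹) (ρ := ((n : ℝ) ^ 6)⁻¹)
      (by positivity) ?_ (hθ l).1 (hθ l).2 (hθ0 l) (hxw l))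
    · refine mul_le_mul_of_nonneg_right ?_ (kernel_nonneg hx)
      have h1 : ((n : ℝ) ^ 6)⁻¹ / ((n : ℝ) ^ 4)⁻¹ = 1 / n * (1 / n) := by field_simp
      have h2 : (k : ℝ) * (1 / n * (1 / n)) ≤ n * (1 / n * (1 / n)) := by gcongr
      have h3 : (n : ℝ) * (1 / n * (1 / n)) = 1 / n := by field_simp
      rw [h1]
      linarith
    · exact inv_anti₀ (by positivity) (pow_le_pow_right₀ (by linarith) (by norm_num))
  have hq3 : q ^ 3 ≤ q := pow_le_of_le_one hq0 hq1 (by norm_num)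
  unfold mixDensity
  rw [mul_add, Finset.mul_sum]
  refine add_le_add (Finset.sum_le_sum fun j _ => ?_) ?_
  · rw [← mul_assoc]
    refine mul_le_mul_of_nonneg_right (le_trans ?_ (hβ _)) (kernel_nonneg hx)
    exact mul_le_mul_of_nonneg_right hq3 (hβ₀ _)
  · calc q ^ 3 * (β₀ (Fin.last k) * ∑ l, w₀ l * kernel k x (θ₀ l))
        = (q * β₀ (Fin.last k)) * ∑ l, (q * w₀ l) * (q * kernel k x (θ₀ l)) := by
          have : ∀ l, (q * w₀ l) * (q * kernel k x (θ₀ l))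
            = q ^ 2 * (w₀ l * kernel k x (θ₀ l)) := fun l => by ring
          simp only [this]
          rw [← Finset.mul_sum]
          ring
      _ ≤ β (Fin.last k) * ∑ l, w l * kernel k x (θ l) := by
          refine mul_le_mul (hβ _) (Finset.sum_le_sum fun l _ => ?_)
            (Finset.sum_nonneg fun l _ => ?_) ((mul_nonneg hq0 (hβ₀ _)).trans (hβ _))
          · exact mul_le_mul (hw l) (hker l) (mul_nonneg hq0 (kernel_nonneg hx))
              ((mul_nonneg hq0 (hw₀ l)).trans (hw l))
          · exact mul_nonneg (mul_nonneg hq0 (hw₀ l)) (mul_nonneg hq0 (kernel_nonneg hx))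

/-- The lower bound `n ^ (-2 D max(k, J))` for the evidence relative to the true likelihood, valid
for every sample that avoids the windows to the left of the true support points. -/
lemma exists_evidence_ge {a : (k : ℕ) → Fin (k + 1) → ℝ} {aLo aHi : ℝ} (haLo : 0 < aLo)
    (ha : ∀ k, 1 ≤ k → ∀ j, aLo ≤ a k j ∧ a k j ≤ aHi) {ω : (J : ℕ) → Fin J → ℝ}
    (hω : ∀ J j, 0 < ω J j) {r c : ℝ} (hr : 0 < r) (hc : 0 < c) {t C : ℝ} (hC : 0 < C)
    {ωLo ωHi : ℝ} (hωLo : 0 < ωLo) :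
    ∃ D : ℕ, ∀ (n : ℕ) (H : Measure ℝ), 2 ≤ n → IsProbabilityMeasure H →
      (∀ u v : ℝ, ((n : ℝ) ^ 2)⁻¹ ≤ u → u < v → v ≤ 1 → C * (v - u) ^ t ≤ H.real (Set.Ioo u v)) →
      ∀ (k J : ℕ) (β₀ : Fin (k + 1) → ℝ) (w₀ θ₀ : Fin J → ℝ), 1 ≤ k → 1 ≤ J → k ≤ n → J ≤ n →
      β₀ ∈ stdSimplex ℝ (Fin (k + 1)) → w₀ ∈ stdSimplex ℝ (Fin J) →
      (∀ l, 2 * ((n : ℝ) ^ 2)⁻¹ ≤ θ₀ l ∧ θ₀ l < 1) → (∀ l, ωLo ≤ ω J l ∧ ω J l ≤ ωHi) →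
      ∀ x : Fin n → ℝ,
        (∀ i, x i ∈ Set.Ioo (0 : ℝ) 1 ∧ 0 < mixDensity k J β₀ w₀ θ₀ (x i)) →
        (∀ i l, x i ∉ Set.Ioo (θ₀ l - ((n : ℝ) ^ 4)⁻¹) (θ₀ l)) →
        1 ≤ ((n : ℝ≥0∞) ^ (D * max k J)) ^ 2 *
          ∫⁻ ξ, likelihoodRatio (mixDensity k J β₀ w₀ θ₀) x ξ ∂prior n r c a ω H := by
  obtain ⟨D₁, hD₁⟩ := exists_geomWeight_ge hr
  obtain ⟨D₂, hD₂⟩ := exists_geomWeight_ge hc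
  obtain ⟨D₃, hD₃⟩ := exists_dirichlet_ge (hi := aHi) haLo
  obtain ⟨D₄, hD₄⟩ := exists_dirichlet_ge (hi := ωHi) hωLo
  obtain ⟨D₅, hD₅⟩ := rpow_window_ge (t := t) hC
  obtain ⟨D₆, hD₆⟩ := exists_inv_pow_le (Real.exp_pos (-6))
  refine ⟨D₁ + D₂ + 2 * D₃ + D₄ + D₅ + D₆, ?_⟩
  intro n H hn hH hHlow k J β₀ w₀ θ₀ hk hJ hkn hJn hβ₀ hw₀ hθ₀ hωb x hx hxw
  set g₀ := mixDensity k J β₀ w₀ θ₀ with hg₀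
  have hn' : (2 : ℝ) ≤ n := by exact_mod_cast hn
  have ha' : ∀ k, 1 ≤ k → ∀ j, 0 < a k j := fun k hk j => haLo.trans_le (ha k hk j).1
  have hprob := isProbabilityMeasure_dirichlet (ha' k hk)
  have hprob' := isProbabilityMeasure_dirichlet (hω J)
  set q : ℝ := 1 - 1 / n with hq
  have hq0 : 0 ≤ q := by
    rw [hq, sub_nonneg, div_le_one (by linarith)]; linarith
  have hn64 : ((n : ℝ) ^ 6)⁻¹ < ((n : ℝ) ^ 2)⁻¹ :=
    inv_strictAnti₀ (by positivity) (pow_lt_pow_right₀ (by linarith) (by norm_num))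
  set T : Set (LayerParam (k, J)) := {β | ∀ j, q * β₀ j ≤ β j} ×ˢ ({w | ∀ l, q * w₀ l ≤ w l} ×ˢ
    Set.univ.pi fun l => Set.Ioo (θ₀ l - ((n : ℝ) ^ 6)⁻¹) (θ₀ l)) with hT
  have hTmass : ((n : ℝ≥0∞) ^ (D₃ * (k + 1)))⁻¹ * (((n : ℝ≥0∞) ^ (D₄ * J))⁻¹ *
      ((n : ℝ≥0∞) ^ (D₅ * J))⁻¹) ≤ layer a ω H (k, J) T := by
    rw [layer, hT, Measure.prod_prod, Measure.prod_prod, Measure.pi_pi]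
    refine mul_le_mul' (hD₃ n hn (k + 1) (by omega) (by omega) _ (ha k hk) _ hβ₀)
      (mul_le_mul' (hD₄ n hn J hJ (by omega) _ hωb _ hw₀) ?_)
    calc ((n : ℝ≥0∞) ^ (D₅ * J))⁻¹ = ∏ _l : Fin J, ((n : ℝ≥0∞) ^ D₅)⁻¹ := by
          rw [Finset.prod_const, Finset.card_univ, Fintype.card_fin, pow_mul, ENNReal.inv_pow]
      _ ≤ _ := Finset.prod_le_prod' fun l _ => by
          have h1 := hHlow (θ₀ l - ((n : ℝ) ^ 6)⁻¹) (θ₀ l) (by linarith [(hθ₀ l).1])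
            (sub_lt_self _ (by positivity)) (hθ₀ l).2.le
          rw [sub_sub_cancel] at h1
          rw [← ofReal_inv_pow hn, ← ofReal_measureReal]
          exact ENNReal.ofReal_le_ofReal ((hD₅ n hn).trans h1)
  -- on the neighbourhood `T` the likelihood ratio is at least `(1 - 1 / n) ^ (3 n) ≥ exp (-6)`
  have hratio : T ⊆ {p | ((n : ℝ≥0∞) ^ D₆)⁻¹ ≤ likelihoodRatio g₀ x ⟨(k, J), p⟩} := by
    rintro p ⟨hp1, hp2, hp3⟩
    have hp3' := fun l => hp3 l trivial
    have hθpos : ∀ l, 0 < p.2.2 l := fun l => by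
      have h1 := (hp3' l).1
      have h2 := (hθ₀ l).1
      have h3 : 0 < ((n : ℝ) ^ 2)⁻¹ := by positivity
      simp only at h1
      linarith
    calc ((n : ℝ≥0∞) ^ D₆)⁻¹ ≤ ENNReal.ofReal ((q ^ 3) ^ n) := by
          rw [← ofReal_inv_pow hn]
          exact ENNReal.ofReal_le_ofReal ((hD₆ n hn).trans (exp_le_one_sub_inv_pow hn))
      _ = ∏ _i : Fin n, ENNReal.ofReal (q ^ 3) := by
          rw [Finset.prod_const, Finset.card_univ, Fintype.card_fin,
            ENNReal.ofReal_pow (by positivity)]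
      _ ≤ likelihoodRatio g₀ x ⟨(k, J), p⟩ := Finset.prod_le_prod' fun i _ => by
          rw [ENNReal.le_div_iff_mul_le (Or.inl (ENNReal.ofReal_pos.2 (hx i).2).ne')
            (Or.inl ENNReal.ofReal_ne_top), ← ENNReal.ofReal_mul (by positivity)]
          exact ENNReal.ofReal_le_ofReal (mul_mixDensity_le hn hkn (hx i).1.1 hβ₀.1 hw₀.1
            hp1 hp2 hp3' hθpos (hxw i))
  have hg₀m : Measurable g₀ := measurable_mixDensity _ _ _ _ _
  have hev : (((n : ℝ≥0∞) ^ (D₁ * k))⁻¹ * ((n : ℝ≥0∞) ^ (D₂ * J))⁻¹) *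
      (((n : ℝ≥0∞) ^ D₆)⁻¹ * (((n : ℝ≥0∞) ^ (D₃ * (k + 1)))⁻¹ * (((n : ℝ≥0∞) ^ (D₄ * J))⁻¹ *
      ((n : ℝ≥0∞) ^ (D₅ * J))⁻¹))) ≤ ∫⁻ ξ, likelihoodRatio g₀ x ξ ∂prior n r c a ω H := by
    rw [lintegral_prior (measurable_likelihoodRatio hg₀m x)]
    refine le_trans ?_ (ENNReal.le_tsum (k, J))
    refine mul_le_mul' (mul_le_mul' (hD₁ n hn k hk) (hD₂ n hn J hJ)) ?_
    refine le_trans (mul_le_mul' le_rfl (hTmass.trans (measure_mono hratio))) ?_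
    exact mul_meas_ge_le_lintegral (measurable_likelihoodRatio_layer hg₀m x (k, J)) _
  have hn0 : (n : ℝ≥0∞) ≠ 0 := by exact_mod_cast (by omega : n ≠ 0)
  have hpow0 : ∀ e, (n : ℝ≥0∞) ^ e ≠ 0 := fun e => pow_ne_zero e hn0
  have hpowt : ∀ e, (n : ℝ≥0∞) ^ e ≠ ⊤ := fun e => ENNReal.pow_ne_top (ENNReal.natCast_ne_top n)
  have hmulinv : ∀ e f, ((n : ℝ≥0∞) ^ e)⁻¹ * ((n : ℝ≥0∞) ^ f)⁻¹ = ((n : ℝ≥0∞) ^ (e + f))⁻¹ :=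
    fun e f => by
      rw [pow_add, ENNReal.mul_inv (Or.inl (hpow0 e)) (Or.inl (hpowt e))]
  simp only [hmulinv] at hev
  set m := max k J with hm
  have hkm : k ≤ m := le_max_left _ _
  have hJm : J ≤ m := le_max_right _ _
  set E := D₁ * k + D₂ * J + (D₆ + (D₃ * (k + 1) + (D₄ * J + D₅ * J))) with hE
  have hEle : E ≤ (D₁ + D₂ + 2 * D₃ + D₄ + D₅ + D₆) * m * 2 := by
    have e1 := Nat.mul_le_mul_left D₁ hkm
    have e2 := Nat.mul_le_mul_left D₂ hJm
    have e3 := Nat.mul_le_mul_left D₃ (by omega : k + 1 ≤ 2 * m)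
    have e4 := Nat.mul_le_mul_left D₄ hJm
    have e5 := Nat.mul_le_mul_left D₅ hJm
    have e6 := Nat.mul_le_mul_left D₆ (by omega : 1 ≤ m)
    nlinarith
  rw [← pow_mul]
  calc (1 : ℝ≥0∞) = (n : ℝ≥0∞) ^ E * ((n : ℝ≥0∞) ^ E)⁻¹ :=
        (ENNReal.mul_inv_cancel (hpow0 E) (hpowt E)).symm
    _ ≤ _ := by
        refine mul_le_mul' (pow_le_pow_right₀ ?_ hEle) hev
        exact_mod_cast (by omega : 1 ≤ n)

/-- Some observation falls into the window of length `n⁻⁴` to the left of a support point. -/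
def windowEvent (n : ℕ) {J : ℕ} (θ₀ : Fin J → ℝ) : Set (Fin n → ℝ) :=
  ⋃ i, ⋃ l, {x | x i ∈ Set.Ioo (θ₀ l - ((n : ℝ) ^ 4)⁻¹) (θ₀ l)}

lemma measurableSet_windowEvent (n : ℕ) {J : ℕ} (θ₀ : Fin J → ℝ) :
    MeasurableSet (windowEvent n θ₀) :=
  MeasurableSet.iUnion fun i => MeasurableSet.iUnion fun _ =>
    measurable_pi_apply i measurableSet_Ioo

lemma measure_windowEvent_le {n k J : ℕ} (hn : 2 ≤ n) (hkn : k ≤ n) (hJn : J ≤ n)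
    {β₀ : Fin (k + 1) → ℝ} {w₀ θ₀ : Fin J → ℝ} {δ : ℝ}
    (hβ₀ : β₀ ∈ stdSimplex ℝ (Fin (k + 1))) (hw₀ : w₀ ∈ stdSimplex ℝ (Fin J)) (hδ : 0 < δ)
    (hδ1 : δ ≤ 1) (hθ₀ : ∀ l, δ ≤ θ₀ l)
    [IsProbabilityMeasure (law (mixDensity k J β₀ w₀ θ₀))] :
    (Measure.pi fun _ : Fin n => law (mixDensity k J β₀ w₀ θ₀)) (windowEvent n θ₀)
      ≤ ENNReal.ofReal (1 / (δ * n)) := by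
  have hn0 : (0 : ℝ) < n := by exact_mod_cast (by omega : 0 < n)
  have hk' : (k : ℝ) ≤ n := by exact_mod_cast hkn
  have hlaw : ∀ l, law (mixDensity k J β₀ w₀ θ₀) (Set.Ioo (θ₀ l - ((n : ℝ) ^ 4)⁻¹) (θ₀ l))
      ≤ ENNReal.ofReal (1 / (δ * (n : ℝ) ^ 3)) := fun l => by
    rw [law, withDensity_apply _ measurableSet_Ioo, Measure.restrict_restrict measurableSet_Ioo]
    calc _ ≤ ∫⁻ _ in Set.Ioo (θ₀ l - ((n : ℝ) ^ 4)⁻¹) (θ₀ l) ∩ Set.Ioo 0 1,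
          ENNReal.ofReal (n / δ) := by
          refine setLIntegral_mono' (measurableSet_Ioo.inter measurableSet_Ioo) fun y hy => ?_
          refine ENNReal.ofReal_le_ofReal ((mixDensity_le hβ₀ hw₀ hδ hδ1 hθ₀ hy.2.1).trans ?_)
          gcongr
      _ ≤ ENNReal.ofReal (n / δ) * volume (Set.Ioo (θ₀ l - ((n : ℝ) ^ 4)⁻¹) (θ₀ l)) := by
          rw [setLIntegral_const]
          gcongr
          exact Set.inter_subset_left
      _ = _ := by
          rw [Real.volume_Ioo, sub_sub_cancel, ← ENNReal.ofReal_mul (by positivity)]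
          congr 1
          field_simp
  calc _ ≤ ∑ _i : Fin n, ∑ _l : Fin J, ENNReal.ofReal (1 / (δ * (n : ℝ) ^ 3)) := by
        refine (measure_iUnion_fintype_le _ _).trans (Finset.sum_le_sum fun i _ => ?_)
        refine (measure_iUnion_fintype_le _ _).trans (Finset.sum_le_sum fun l _ => ?_)
        refine le_trans (le_of_eq ?_) (hlaw l)
        exact (measurePreserving_eval (fun _ : Fin n => law (mixDensity k J β₀ w₀ θ₀))
          i).measure_preimage measurableSet_Ioo.nullMeasurableSet
    _ = (n * (J * ENNReal.ofReal (1 / (δ * (n : ℝ) ^ 3))) : ℝ≥0∞) := by simp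
    _ ≤ (n * (n * ENNReal.ofReal (1 / (δ * (n : ℝ) ^ 3))) : ℝ≥0∞) := by gcongr
    _ = _ := by
        rw [← ENNReal.ofReal_natCast n, ← ENNReal.ofReal_mul hn0.le, ← ENNReal.ofReal_mul hn0.le]
        congr 1
        field_simp

/-! ### Contraction -/

lemma law_Iio_le {p : ℝ → ℝ} {s t C : ℝ} (ht : 0 < t)
    (hp : ∀ θ, 0 < θ → θ < s → p θ ≤ C * Real.exp (-t / θ)) (hC : 0 < C) :
    law p (Set.Iio s) ≤ ENNReal.ofReal (C * Real.exp (-t / s)) := by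
  rw [law, withDensity_apply _ measurableSet_Iio, Measure.restrict_restrict measurableSet_Iio]
  calc _ ≤ ∫⁻ _ in Set.Iio s ∩ Set.Ioo 0 1, ENNReal.ofReal (C * Real.exp (-t / s)) := by
        refine setLIntegral_mono' (measurableSet_Iio.inter measurableSet_Ioo) fun y hy => ?_
        have hy0 : 0 < y := hy.2.1
        have hys : y < s := hy.1
        refine ENNReal.ofReal_le_ofReal ((hp y hy0 hys).trans ?_)
        gcongr C * Real.exp ?_
        rw [neg_div, neg_div, neg_le_neg_iff]
        gcongr
    _ ≤ ENNReal.ofReal (C * Real.exp (-t / s)) * volume (Set.Ioo (0 : ℝ) 1) := by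
        rw [setLIntegral_const]
        gcongr
        exact Set.inter_subset_right
    _ = _ := by simp

lemma sq_pow_mul_geometric_le {n D A m : ℕ} {s : ℝ} (hn : 2 ≤ n) (hm : 1 ≤ m)
    (hA : 2 * D + 1 ≤ s * A) :
    ((n : ℝ≥0∞) ^ (D * m)) ^ 2 * ENNReal.ofReal (((n : ℝ) ^ (-s)) ^ (A * m))
      ≤ ENNReal.ofReal (1 / n) := by
  have hn' : (2 : ℝ) ≤ n := by exact_mod_cast hn
  have h1 : ((n : ℝ) ^ (-s)) ^ A ≤ ((n : ℝ) ^ (2 * D + 1))⁻¹ := by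
    rw [← Real.rpow_natCast, ← Real.rpow_mul (by linarith), ← Real.rpow_natCast,
      ← Real.rpow_neg (by linarith)]
    refine Real.rpow_le_rpow_of_exponent_le (by linarith) ?_
    push_cast
    linarith
  rw [← ENNReal.ofReal_natCast n, ← ENNReal.ofReal_pow (by linarith),
    ← ENNReal.ofReal_pow (by positivity), ← ENNReal.ofReal_mul (by positivity)]
  refine ENNReal.ofReal_le_ofReal ?_
  calc (((n : ℝ) ^ (D * m)) ^ 2) * ((n : ℝ) ^ (-s)) ^ (A * m)
      ≤ (((n : ℝ) ^ (D * m)) ^ 2) * (((n : ℝ) ^ (2 * D + 1))⁻¹) ^ m := by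
        rw [pow_mul ((n : ℝ) ^ (-s))]
        gcongr
    _ = ((n : ℝ) ^ m)⁻¹ := by
        rw [inv_pow, ← pow_mul, ← pow_mul, add_mul, pow_add, one_mul,
          show D * m * 2 = 2 * D * m by ring]
        field_simp
    _ ≤ 1 / n := by
        rw [one_div]
        exact inv_anti₀ (by linarith) (le_self_pow₀ (by linarith) (by omega))

/-- Support points below `n⁻²` have prior probability of order `exp (-t n ^ 2)`, which is negligible
against the inverse evidence, at most `n ^ (2 D n)`. -/
lemma eventually_pow_mul_exp_le {t : ℝ} (ht : 0 < t) (D : ℕ) :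
    ∀ᶠ n : ℕ in atTop, (n : ℝ) ^ (2 * D * n + 2) * Real.exp (-t * (n : ℝ) ^ 2) ≤ 1 / n := by
  have hlog : ∀ᶠ x : ℝ in atTop, Real.log x ≤ t / (2 * (2 * D + 2)) * x := by
    have := Real.isLittleO_log_id_atTop.def (c := t / (2 * (2 * D + 2))) (by positivity)
    filter_upwards [this, eventually_ge_atTop 0] with x hx hx0
    simp only [id, Real.norm_eq_abs, abs_of_nonneg hx0] at hx
    exact (le_abs_self _).trans hx
  have hlog' := tendsto_natCast_atTop_atTop.eventually hlog
  have hlarge := tendsto_natCast_atTop_atTop.eventually (eventually_ge_atTop (2 / t))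
  filter_upwards [hlog', hlarge, eventually_ge_atTop 1] with n h1 h2 h3
  have hn : (1 : ℝ) ≤ n := by exact_mod_cast h3
  have hn0 : (0 : ℝ) < n := by linarith
  have hl0 : 0 ≤ Real.log n := Real.log_nonneg hn
  have hexp : (n : ℝ) ^ (2 * D * n + 2) * Real.exp (-t * (n : ℝ) ^ 2) ≤ Real.exp (-n) := by
    rw [← Real.exp_log hn0, ← Real.exp_nat_mul, Real.exp_log hn0, ← Real.exp_add]
    refine Real.exp_le_exp.2 ?_
    push_cast
    have e1 : (2 * D * n + 2 : ℝ) * Real.log n ≤ (2 * D + 2) * n * Real.log n := by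
      refine mul_le_mul_of_nonneg_right ?_ hl0
      nlinarith
    have e2 : (2 * D + 2 : ℝ) * n * Real.log n ≤ (2 * D + 2) * n * (t / (2 * (2 * D + 2)) * n) := by
      gcongr
    have e3 : (2 * D + 2 : ℝ) * n * (t / (2 * (2 * D + 2)) * n) = t / 2 * n ^ 2 := by
      field_simp
    have e4 : (n : ℝ) ≤ t / 2 * n ^ 2 := by
      rw [div_le_iff₀ ht] at h2
      nlinarith
    linarith
  refine hexp.trans ?_
  rw [Real.exp_neg, one_div]
  exact inv_anti₀ hn0 (by linarith [Real.add_one_le_exp (n : ℝ)])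

lemma card_brackets_le {n A m : ℕ} (hn : 2 ≤ n) (hA : A + 1 ≤ n) (hm : 1 ≤ m) (hmn : m ≤ n) :
    A * m + 1 ≤ n ^ 2 ∧
      (A * m + 1) ^ 2 * (n ^ 6 + 1) ^ (3 * (A * m) + 1) ≤ n ^ ((11 + 21 * A) * m) := by
  have h1 : A * m + 1 ≤ n ^ 2 := by nlinarith
  refine ⟨h1, ?_⟩
  have h2 : n ^ 6 + 1 ≤ n ^ 7 := by
    have : 1 ≤ n ^ 6 := Nat.one_le_pow _ _ (by omega)
    calc n ^ 6 + 1 ≤ n ^ 6 * 2 := by omega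
      _ ≤ n ^ 6 * n := by gcongr
      _ = n ^ 7 := by ring
  calc (A * m + 1) ^ 2 * (n ^ 6 + 1) ^ (3 * (A * m) + 1)
      ≤ (n ^ 2) ^ 2 * (n ^ 7) ^ (3 * (A * m) + 1) := by gcongr
    _ = n ^ (4 + 7 * (3 * (A * m) + 1)) := by rw [← pow_mul, ← pow_mul, ← pow_add]
    _ ≤ n ^ ((11 + 21 * A) * m) := Nat.pow_le_pow_right (by omega) (by nlinarith)

/-- The union bound over the brackets: `n ^ (F m)` brackets of affinity `1 + 1 / n - h ^ 2 / 2` are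
negligible once `n h ^ 2 / 2 ≥ (F + 1) m log n`. -/
lemma pow_mul_affinity_pow_le {n F m : ℕ} {h : ℝ} (hn : 2 ≤ n) (hm : 1 ≤ m)
    (hh : (F + 1) * m * Real.log n ≤ n * h ^ 2 / 2) :
    (n : ℝ≥0∞) ^ (F * m) * ENNReal.ofReal (1 + 1 / n - h ^ 2 / 2) ^ n
      ≤ ENNReal.ofReal (3 / n) := by
  have hn' : (2 : ℝ) ≤ n := by exact_mod_cast hn
  have hn0 : (0 : ℝ) < n := by linarith
  have h1 : 1 + 1 / n - h ^ 2 / 2 ≤ Real.exp (1 / n - h ^ 2 / 2) := by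
    have := Real.add_one_le_exp (1 / (n : ℝ) - h ^ 2 / 2)
    linarith
  have h2 : ENNReal.ofReal (1 + 1 / n - h ^ 2 / 2) ^ n
      ≤ ENNReal.ofReal (3 * ((n : ℝ) ^ ((F + 1) * m))⁻¹) := by
    refine (pow_le_pow_left' (ENNReal.ofReal_le_ofReal h1) n).trans ?_
    rw [← ENNReal.ofReal_pow (Real.exp_pos _).le, ← Real.exp_nat_mul]
    refine ENNReal.ofReal_le_ofReal ?_
    have h3 : (n : ℝ) * (1 / n - h ^ 2 / 2) = 1 - n * h ^ 2 / 2 := by field_simp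
    have h4 : ((n : ℝ) ^ ((F + 1) * m))⁻¹ = Real.exp (-((F + 1) * m * Real.log n)) := by
      rw [Real.exp_neg, ← Real.exp_log hn0, ← Real.exp_nat_mul, Real.exp_log hn0]
      push_cast
      rfl
    rw [h3, h4]
    calc Real.exp (1 - n * h ^ 2 / 2) ≤ Real.exp (1 + -((F + 1) * m * Real.log n)) :=
          Real.exp_le_exp.2 (by linarith)
      _ = Real.exp 1 * Real.exp (-((F + 1) * m * Real.log n)) := Real.exp_add _ _
      _ ≤ _ := by
          gcongr
          exact (Real.exp_one_lt_d9.le).trans (by norm_num)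
  refine (mul_le_mul' le_rfl h2).trans ?_
  rw [← ENNReal.ofReal_natCast n, ← ENNReal.ofReal_pow hn0.le, ← ENNReal.ofReal_mul (by positivity)]
  refine ENNReal.ofReal_le_ofReal ?_
  calc (n : ℝ) ^ (F * m) * (3 * ((n : ℝ) ^ ((F + 1) * m))⁻¹) = 3 * ((n : ℝ) ^ m)⁻¹ := by
        rw [add_mul, one_mul, pow_add]
        field_simp
    _ ≤ 3 * (n : ℝ)⁻¹ := by
        gcongr
        exact le_self_pow₀ (by linarith) (by omega)
    _ = 3 / n := by ring

lemma posterior_eq_zero {n : ℕ} {r c : ℝ} {a : (k : ℕ) → Fin (k + 1) → ℝ}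
    {ω : (J : ℕ) → Fin J → ℝ} {H : Measure ℝ} (ha : ∀ k, 1 ≤ k → ∀ j, 0 < a k j)
    (hω : ∀ J j, 0 < ω J j) [IsProbabilityMeasure H] (hH : ∀ᵐ θ ∂H, θ ∈ Set.Ioo (0 : ℝ) 1)
    {g₀ : ℝ → ℝ} (hg₀1 : ∫⁻ y in Set.Ioo 0 1, ENNReal.ofReal (g₀ y) = 1)
    (hg₀0 : ∀ y ∈ Set.Ioo (0 : ℝ) 1, 0 ≤ g₀ y) {h : ℝ} (hh : 0 ≤ h) (hh2 : 2 < h ^ 2)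
    (x : Fin n → ℝ) :
    posterior (prior n r c a ω H) x {ξ | ENNReal.ofReal h ≤ hellinger ξ.density g₀} = 0 := by
  have hnull : prior n r c a ω H {ξ | ENNReal.ofReal h ≤ hellinger ξ.density g₀} = 0 := by
    refine measure_eq_zero_iff_ae_notMem.2 ?_
    filter_upwards [ae_prior (n := n) (r := r) (c := c) ha hω hH] with ξ hadm hξ
    have h1 := hellinger_sq_le (measurable_density ξ) hadm.lintegral_density hg₀1
      (fun y hy => hadm.density_nonneg hy.1) hg₀0
    have h2 : ENNReal.ofReal (h ^ 2) ≤ ENNReal.ofReal 2 := by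
      rw [ENNReal.ofReal_pow hh, ENNReal.ofReal_ofNat]
      exact (pow_le_pow_left' hξ 2).trans h1
    rw [ENNReal.ofReal_le_ofReal_iff (by norm_num)] at h2
    linarith
  rw [posterior, setLIntegral_measure_zero _ _ hnull, ENNReal.zero_div]

end KMonotone

theorem theorem5
    -- parameters of the Dirichlet priors of `β` given `k`
    (a : (k : ℕ) → Fin (k + 1) → ℝ) (aLo aHi : ℝ) (haLo : 0 < aLo)
    (ha : ∀ k, 1 ≤ k → ∀ j, aLo ≤ a k j ∧ a k j ≤ aHi)
    -- parameters of the Dirichlet priors of `w` given `J`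
    (ω : (J : ℕ) → Fin J → ℝ) (hω : ∀ J j, 0 < ω J j)
    -- exponent of the prior of `k`
    (r : ℝ) (hr : 0 < r)
    -- the distribution of a support point at sample size `n`, with its density on `(0, 1)`
    (H : ℕ → Measure ℝ) (pH : ℕ → ℝ → ℝ)
    (hH : ∀ n, 2 ≤ n → IsProbabilityMeasure (H n)) (hpH : ∀ n, 2 ≤ n → Measurable (pH n))
    (hHp : ∀ n, 2 ≤ n → H n = KMonotone.law (pH n))
    (t₂ t₃ C₁ C₂ : ℝ) (ht₂ : 0 < t₂) (ht₃ : 0 < t₃) (hC₁ : 0 < C₁) (hC₂ : 0 < C₂)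
    (hH_lower : ∀ n : ℕ, 2 ≤ n → ∀ u v : ℝ, ((n : ℝ) ^ 2)⁻¹ ≤ u → u < v → v ≤ 1 →
      C₁ * (v - u) ^ t₂ ≤ (H n).real (Set.Ioo u v))
    (hH_upper : ∀ n : ℕ, 2 ≤ n → ∀ θ : ℝ, 0 < θ → θ < ((n : ℝ) ^ 2)⁻¹ →
      pH n θ ≤ C₂ * Real.exp (-t₃ / θ)) :
    -- the exponent of the prior of `J` is sufficiently large, irrespective of the truth
    ∃ c₀ : ℝ, 0 < c₀ ∧ ∀ c : ℝ, c₀ ≤ c →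
      -- the truth, which may vary with `n`
      ∀ (k₀ J₀ : ℕ → ℕ) (β₀ : (n : ℕ) → Fin (k₀ n + 1) → ℝ) (w₀ θ₀ : (n : ℕ) → Fin (J₀ n) → ℝ),
        (∀ n, 1 ≤ k₀ n) → (∀ n, 1 ≤ J₀ n) →
        (∀ n, β₀ n ∈ stdSimplex ℝ (Fin (k₀ n + 1))) →
        (∀ n, w₀ n ∈ stdSimplex ℝ (Fin (J₀ n))) →
        (∀ n l, θ₀ n l ∈ Set.Ioo (0 : ℝ) 1) →
        -- bounds that hold automatically if the truth does not vary with `n`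
        (∃ b > 0, ∀ n, b ≤ β₀ n 0) →
        (∃ δ > 0, ∀ n l, δ ≤ θ₀ n l) →
        (∃ ωLo > 0, ∃ ωHi, ∀ n l, ωLo ≤ ω (J₀ n) l ∧ ω (J₀ n) l ≤ ωHi) →
        let g₀ : ℕ → ℝ → ℝ := fun n => KMonotone.mixDensity (k₀ n) (J₀ n) (β₀ n) (w₀ n) (θ₀ n)
        let P₀ : (n : ℕ) → Measure (Fin n → ℝ) := fun n =>
          Measure.pi fun _ : Fin n => KMonotone.law (g₀ n)
        let Λ : ℕ → Measure KMonotone.Param := fun n => KMonotone.prior n r c a ω (H n)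
        let ε : ℕ → ℝ := fun n => √((max (k₀ n) (J₀ n) : ℕ) * Real.log n / n)
        -- the posterior is well defined almost surely
        (∀ n, 2 ≤ n → ∀ᵐ x ∂P₀ n,
          KMonotone.evidence (Λ n) x ≠ 0 ∧ KMonotone.evidence (Λ n) x ≠ ⊤) ∧
        -- and it contracts at `g₀` at the rate `ε` in the Hellinger distance
        ∀ M : ℕ → ℝ, Tendsto M atTop atTop →
          Tendsto
            (fun n => ∫⁻ x, KMonotone.posterior (Λ n) x
              {ξ | ENNReal.ofReal (M n * ε n) ≤ KMonotone.hellinger ξ.density (g₀ n)} ∂P₀ n)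
            atTop (𝓝 0) := by
  refine ⟨1, one_pos, ?_⟩
  intro c hc1 k₀ J₀ β₀ w₀ θ₀ hk₀ hJ₀ hβ₀ hw₀ hθ₀ _ ⟨δ, hδ, hδθ⟩ ⟨ωLo, hωLo, ωHi, hωb⟩ g₀ P₀ Λ ε
  have hc : 0 < c := one_pos.trans_le hc1
  have ha' : ∀ k, 1 ≤ k → ∀ j, 0 < a k j := fun k hk j => haLo.trans_le (ha k hk j).1
  have hHae : ∀ n, 2 ≤ n → ∀ᵐ θ ∂H n, θ ∈ Set.Ioo (0 : ℝ) 1 := fun n hn => by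
    rw [hHp n hn]
    exact (KMonotone.ae_law (hpH n hn)).mono fun _ h => h.1
  have hg₀m : ∀ n, Measurable (g₀ n) := fun n => KMonotone.measurable_mixDensity _ _ _ _ _
  have hg₀1 : ∀ n, ∫⁻ y in Set.Ioo 0 1, ENNReal.ofReal (g₀ n y) = 1 := fun n =>
    KMonotone.lintegral_mixDensity_eq_one (hk₀ n) (hβ₀ n) (hw₀ n)
      fun l => ⟨(hθ₀ n l).1, (hθ₀ n l).2.le⟩
  have hg₀0 : ∀ n, ∀ y ∈ Set.Ioo (0 : ℝ) 1, 0 ≤ g₀ n y := fun n y hy =>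
    KMonotone.mixDensity_nonneg (hβ₀ n).1 (hw₀ n).1 hy.1
  have hlaw := fun n => KMonotone.isProbabilityMeasure_law (hg₀1 n)
  refine ⟨fun n hn => ?_, fun M hM => ?_⟩
  · have := hH n hn
    exact KMonotone.ae_evidence_ne hn hr hc ha' hω (hHae n hn) (hg₀m n)
  have hδ1 : δ ≤ 1 := (hδθ 0 ⟨0, hJ₀ 0⟩).trans (hθ₀ 0 ⟨0, hJ₀ 0⟩).2.le
  obtain ⟨D, hD⟩ := KMonotone.exists_evidence_ge (r := r) (c := c) (t := t₂) (ωHi := ωHi)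
    haLo ha hω hr hc hC₁ hωLo
  -- the sieve dimension `A m` is chosen so large that the prior tails beat the evidence bound
  obtain ⟨A, hAr⟩ := exists_nat_ge ((2 * D + 1) / min r c)
  have hrc : 0 < min r c := lt_min hr hc
  rw [div_le_iff₀ hrc] at hAr
  have hAr1 : 2 * (D : ℝ) + 1 ≤ r * A := by
    nlinarith [min_le_left r c, Nat.cast_nonneg (α := ℝ) A]
  have hAc1 : 2 * (D : ℝ) + 1 ≤ c * A := by
    nlinarith [min_le_right r c, Nat.cast_nonneg (α := ℝ) A]
  set F : ℕ := D + (11 + 21 * A) with hF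
  have hbound : ∀ᶠ n in atTop, ∫⁻ x, KMonotone.posterior (Λ n) x
      {ξ | ENNReal.ofReal (M n * ε n) ≤ KMonotone.hellinger ξ.density (g₀ n)} ∂P₀ n
      ≤ ENNReal.ofReal ((1 / δ + (2 + C₂) + 3) / n) := by
    have hlim : Tendsto (fun n : ℕ => ((n : ℝ) ^ 2)⁻¹) atTop (𝓝 0) :=
      (tendsto_inv_atTop_zero.comp (tendsto_pow_atTop two_ne_zero)).comp
        tendsto_natCast_atTop_atTop
    have hsmall : ∀ᶠ n : ℕ in atTop, ((n : ℝ) ^ 2)⁻¹ < δ / 2 :=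
      hlim.eventually (gt_mem_nhds (by positivity))
    filter_upwards [eventually_ge_atTop 3, eventually_ge_atTop (A + 1), hsmall,
      hM.eventually_ge_atTop (2 * (F + 1)), KMonotone.eventually_pow_mul_exp_le ht₃ D]
      with n hn3 hnA hnδ hMn htail
    have hn2 : 2 ≤ n := by omega
    have hn' : (3 : ℝ) ≤ n := by exact_mod_cast hn3
    have hn0 : (0 : ℝ) < n := by linarith
    have := hH n hn2
    have := hlaw n
    set m := max (k₀ n) (J₀ n) with hm
    have hm1 : 1 ≤ m := (hk₀ n).trans (le_max_left _ _)
    have hm1' : (1 : ℝ) ≤ m := by exact_mod_cast hm1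
    have hF0 : (0 : ℝ) ≤ F := F.cast_nonneg
    have hM2 : 2 ≤ M n := by linarith
    have hMsq : 2 * ((F : ℝ) + 1) ≤ M n ^ 2 := by nlinarith
    have hlog1 : 1 ≤ Real.log n := by
      rw [Real.le_log_iff_exp_le hn0]
      exact (Real.exp_one_lt_d9.le).trans (by linarith)
    have hε0 : 0 ≤ ε n := Real.sqrt_nonneg _
    have hεsq : ε n ^ 2 = m * Real.log n / n := Real.sq_sqrt (by positivity)
    have hh0 : 0 ≤ M n * ε n := mul_nonneg (by linarith) hε0
    have hhsq : n * (M n * ε n) ^ 2 = M n ^ 2 * (m * Real.log n) := by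
      rw [mul_pow, hεsq]; field_simp
    rcases lt_or_ge 2 ((M n * ε n) ^ 2) with hbig | hle
    · simp only [Λ, fun x => KMonotone.posterior_eq_zero (r := r) (c := c) ha' hω (hHae n hn2)
        (hg₀1 n) (hg₀0 n) hh0 hbig x, lintegral_zero]
      exact zero_le
    have hmn : m ≤ n := by
      have e1 : n * (M n * ε n) ^ 2 ≤ n * 2 := by gcongr
      have e2 : (4 : ℝ) * (m * 1) ≤ M n ^ 2 * (m * Real.log n) := by
        gcongr
        nlinarith
      have : (m : ℝ) ≤ n := by linarith
      exact_mod_cast this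
    obtain ⟨hK, hcard⟩ := KMonotone.card_brackets_le hn2 hnA hm1 hmn
    obtain ⟨𝒰, h𝒰card, h𝒰m, h𝒰⟩ := KMonotone.exists_upper_brackets hn3 hK
    set S := KMonotone.sieve (A * m) ((n : ℝ) ^ 2)⁻¹ with hS
    set R : Set KMonotone.Param :=
      {ξ | ENNReal.ofReal (M n * ε n) ≤ KMonotone.hellinger ξ.density (g₀ n)} with hR
    classical
    -- only the brackets that contain a parameter far from the truth matter
    set 𝒱 := 𝒰.filter fun u => ∃ ξ ∈ R, ξ.Admissible ∧
      (∀ y ∈ Set.Ioo (0 : ℝ) 1, ξ.density y ≤ u y) ∧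
      ∫⁻ y in Set.Ioo 0 1, ENNReal.ofReal (u y) ≤ ENNReal.ofReal (1 + 1 / (n : ℝ) ^ 2) with h𝒱
    have hpost := KMonotone.lintegral_posterior_le (A := R) (S := S) (𝒰 := 𝒱)
      (d := (n : ℝ≥0∞) ^ (D * m)) (ρ := ENNReal.ofReal (1 + 1 / n - (M n * ε n) ^ 2 / 2))
      hn2 hr hc ha' hω (hHae n hn2) (hg₀m n) (hg₀0 n)
      (KMonotone.measurableSet_sieve _ _)
      (KMonotone.measurableSet_windowEvent n (θ₀ n))
      (fun x hxB hx => hD n (H n) hn2 (hH n hn2) (hH_lower n hn2) (k₀ n) (J₀ n) (β₀ n) (w₀ n)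
        (θ₀ n) (hk₀ n) (hJ₀ n) ((le_max_left _ _).trans hmn) ((le_max_right _ _).trans hmn)
        (hβ₀ n) (hw₀ n) (fun l => ⟨by linarith [hδθ n l], (hθ₀ n l).2⟩) (hωb n) x hx
        fun i l hil => hxB (Set.mem_iUnion.2 ⟨i, Set.mem_iUnion.2 ⟨l, hil⟩⟩))
      (fun u hu => h𝒰m u (Finset.mem_filter.1 hu).1)
      (fun ξ hξR hξS hξ => by
        obtain ⟨u, hu, hu1, hu2⟩ := h𝒰 ξ hξ hξS
        exact ⟨u, Finset.mem_filter.2 ⟨hu, ξ, hξR, hξ, hu1, hu2⟩, hu1⟩)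
      (fun u hu => by
        obtain ⟨hu, ξ, hξR, hξ, hu1, hu2⟩ := Finset.mem_filter.1 hu
        exact KMonotone.lintegral_sqrt_mul_le hn2 hh0 (KMonotone.measurable_density ξ) (hg₀m n)
          (h𝒰m u hu) hξ.lintegral_density (hg₀1 n) (fun y hy => hξ.density_nonneg hy.1)
          (hg₀0 n) hu1 hu2 hξR)
    refine hpost.trans ?_
    have hterm1 : (Measure.pi fun _ : Fin n => KMonotone.law (g₀ n))
        (KMonotone.windowEvent n (θ₀ n)) ≤ ENNReal.ofReal (1 / (δ * n)) :=
      KMonotone.measure_windowEvent_le hn2 ((le_max_left _ _).trans hmn)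
        ((le_max_right _ _).trans hmn) (hβ₀ n) (hw₀ n) hδ hδ1 (hδθ n)
    have hIio : ((n : ℝ≥0∞) ^ (D * m)) ^ 2 * (((A * m : ℕ) : ℝ≥0∞) *
        H n (Set.Iio ((n : ℝ) ^ 2)⁻¹)) ≤ ENNReal.ofReal (C₂ / n) := by
      have h1 : H n (Set.Iio ((n : ℝ) ^ 2)⁻¹)
          ≤ ENNReal.ofReal (C₂ * Real.exp (-t₃ * (n : ℝ) ^ 2)) := by
        have h2 := KMonotone.law_Iio_le (p := pH n) ht₃ (hH_upper n hn2) hC₂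
        rw [div_inv_eq_mul] at h2
        rw [hHp n hn2]
        exact h2
      have h3 : ((A * m : ℕ) : ℝ≥0∞) ≤ (n : ℝ≥0∞) ^ 2 := by
        exact_mod_cast (by omega : A * m ≤ n ^ 2)
      have h4 : ((n : ℝ≥0∞) ^ (D * m)) ^ 2 ≤ (n : ℝ≥0∞) ^ (2 * D * n) := by
        rw [← pow_mul]
        refine pow_le_pow_right₀ (by exact_mod_cast (by omega : 1 ≤ n)) ?_
        calc D * m * 2 = 2 * D * m := by ring
          _ ≤ 2 * D * n := Nat.mul_le_mul_left _ hmn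
      calc _ ≤ (n : ℝ≥0∞) ^ (2 * D * n) * ((n : ℝ≥0∞) ^ 2 *
            ENNReal.ofReal (C₂ * Real.exp (-t₃ * (n : ℝ) ^ 2))) := by gcongr
        _ = ENNReal.ofReal (C₂ * ((n : ℝ) ^ (2 * D * n + 2) *
            Real.exp (-t₃ * (n : ℝ) ^ 2))) := by
            rw [← mul_assoc, ← pow_add, ← ENNReal.ofReal_natCast n,
              ← ENNReal.ofReal_pow hn0.le, ← ENNReal.ofReal_mul (by positivity)]
            congr 1
            ring
        _ ≤ _ := by
            refine ENNReal.ofReal_le_ofReal ?_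
            calc _ ≤ C₂ * (1 / n) := by gcongr
              _ = C₂ / n := by ring
    have hterm2 : ((n : ℝ≥0∞) ^ (D * m)) ^ 2 * KMonotone.prior n r c a ω (H n) Sᶜ
        ≤ ENNReal.ofReal (1 / n) + ENNReal.ofReal (1 / n) + ENNReal.ofReal (C₂ / n) := by
      refine (mul_le_mul' le_rfl (KMonotone.prior_compl_sieve_le hn2 hr hc ha' hω (A * m) _)).trans
        ?_
      rw [mul_add, mul_add]
      gcongr
      · exact KMonotone.sq_pow_mul_geometric_le hn2 hm1 hAr1
      · exact KMonotone.sq_pow_mul_geometric_le hn2 hm1 hAc1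
    have hterm3 : (n : ℝ≥0∞) ^ (D * m) *
        (𝒱.card * ENNReal.ofReal (1 + 1 / n - (M n * ε n) ^ 2 / 2) ^ n)
        ≤ ENNReal.ofReal (3 / n) := by
      have h1 : (𝒱.card : ℝ≥0∞) ≤ (n : ℝ≥0∞) ^ ((11 + 21 * A) * m) := by
        exact_mod_cast ((Finset.card_filter_le _ _).trans h𝒰card).trans hcard
      have h2 : ((F : ℝ) + 1) * m * Real.log n ≤ n * (M n * ε n) ^ 2 / 2 := by
        rw [hhsq, mul_assoc]
        have : 0 ≤ m * Real.log n := by positivity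
        nlinarith
      refine le_trans ?_ (KMonotone.pow_mul_affinity_pow_le hn2 hm1 h2)
      rw [hF, add_mul, pow_add, mul_assoc]
      gcongr
    refine (add_le_add (add_le_add hterm1 hterm2) hterm3).trans (le_of_eq ?_)
    rw [← ENNReal.ofReal_add (by positivity) (by positivity),
      ← ENNReal.ofReal_add (by positivity) (by positivity),
      ← ENNReal.ofReal_add (by positivity) (by positivity),
      ← ENNReal.ofReal_add (by positivity) (by positivity)]
    congr 1
    field_simp
    ring
  have hzero : Tendsto (fun n : ℕ => ENNReal.ofReal ((1 / δ + (2 + C₂) + 3) / n)) atTop (𝓝 0) := by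
    rw [← ENNReal.ofReal_zero]
    exact ENNReal.tendsto_ofReal (tendsto_const_div_atTop_nhds_zero_nat _)
  exact tendsto_of_tendsto_of_tendsto_of_le_of_le' tendsto_const_nhds hzero
    (Eventually.of_forall fun _ => zero_le) hbound
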